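/- Let $0<T\le\infty$. Consider the shallow water equations on a plane sloping beach, in dimensionless form, $$\partial_t\eta+\partial_x[(x+\eta)u]=0,\qquad \partial_t u+u\,\partial_x u+\partial_x\eta=0,$$ on the wet region $D=\{(x,t): 0\le t<T,\ x\ge x_0(t)\}$, where the shoreline $x_0$ is a continuous function on $[0,T)$ with $x_0(t)+\eta(x_0(t),t)=0$ and $x+\eta(x,t)>0$ for $x>x_0(t)$. Let $(\eta,u)$ be a classical solution that is $C^2$ up to the boundary of $D$ (each of $\eta,u$ is the restriction to $D$ of a function that is $C^2$ near every point of $D$), with initial displacement $\eta(x,0)=\eta_0(x)$ and zero initial velocity $u(x,0)=0$ for $x\ge x_0(0)$. Assume that the wave does not break on $[0,T)$: with $\sigma=\sqrt{x+\eta}$ and $\tau=(t-u)/2$, the Jacobian $\partial(\sigma,\tau)/\partial(x,t)$ of the Carrier–Greenspan map does not vanish at the points of $D$ with $x>x_0(t)$, and $\partial(\sigma^2,\tau)/\partial(x,t)\ne0$ on the shoreline $x=x_0(t)$. Write $v_0=dx_0/dt$ (one-sided at $t=0$), $\theta(t)=(t-v_0(t))/2$, $\Theta=\theta([0,T))$,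 and $(\mathcal A f)(\sigma)=\int_0^\sigma f(s)\,(\sigma^2-s^2)^{-1/2}\,ds$ for the Abel transform. Then: 0. $x_0$ is differentiable and $v_0(t)=u(x_0(t),t)$ for $0\le t<T$. 1. $\theta(0)=0$, $\theta$ is strictly increasing on $[0,T)$ and $\Theta$ is an interval, so that $$\Psi(\tau)=-x_0(t)+v_0(t)^2/2,\qquad \tau=(t-v_0(t))/2,$$ defines a function $\Psi$ on $\Theta$ in terms of the shoreline motion alone. 2. For every $\sigma\in\Theta$ the equation $x+\eta_0(x)=\sigma^2$ has exactly one solution $x=\gamma(\sigma)\ge x_0(0)$. Put $\psi_0(\sigma)=\eta_0(\gamma(\sigma))$. For every $\sigma\in\Theta$ with $\sigma>0$ the integral $(\mathcal A\Psi)(\sigma)$ converges absolutely and $$\psi_0(\sigma)=\frac2\pi(\mathcal A\Psi)(\sigma).$$ 3. For every $x>x_0(0)$ with $\sqrt{x+\eta_0(x)}\in\Theta$, $$\eta_0(x)=\psi_0(\sigma)=\frac2\pi(\mathcal A\Psi)(\sigma),\qquad \sigma=\sqrt{x+\eta_0(x)},$$ and $y=\eta_0(x)$ is the only real number with $x+y>0$,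 $\sqrt{x+y}\in\Theta$ and $y=\frac2\pi(\mathcal A\Psi)(\sqrt{x+y})$. Moreover $\eta_0(x_0(0))=-x_0(0)$. 4. If $T=\infty$, then $\sqrt{x+\eta_0(x)}\in\Theta$ for every $x\ge x_0(0)$, so that the whole initial displacement is determined by the shoreline motion. -/

import Mathlib

namespace SlopingBeach

noncomputable section

/-- The time interval `[0, T)`, where `T = ⊤` gives all times `t ≥ 0`. -/
def times (T : EReal) : Set ℝ := {t | 0 ≤ t ∧ (t : EReal) < T}

/-- The wet region, with points written `(x, t)`; the shoreline `x = x₀ t` is included. -/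
def wet (T : EReal) (x₀ : ℝ → ℝ) : Set (ℝ × ℝ) := {p | p.2 ∈ times T ∧ x₀ p.2 ≤ p.1}

/-- Partial derivative in the first variable `x`. -/
def dx (f : ℝ → ℝ → ℝ) (x t : ℝ) : ℝ := deriv (fun y => f y t) x

/-- Partial derivative in the second variable `t`. -/
def dt (f : ℝ → ℝ → ℝ) (x t : ℝ) : ℝ := deriv (fun s => f x s) t

/-- The total depth `H(x, t) = x + η(x, t)`. -/
def depth (η : ℝ → ℝ → ℝ) (x t : ℝ) : ℝ := x + η x t

/-- `(η, u)` is a classical solution, of class `C²` up to the boundary of the wet region, of the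
shallow water equations over the plane beach on `[0, T)`, with moving shoreline `x₀`.
Regularity up to the boundary means that `η` and `u` are restrictions of functions which are `C²`
near each point of the wet region; the values outside the wet region are irrelevant. -/
structure IsFlow (T : EReal) (η u : ℝ → ℝ → ℝ) (x₀ : ℝ → ℝ) : Prop where
  shore_cont : ContinuousOn x₀ (times T)
  shore_eq : ∀ t ∈ times T, depth η (x₀ t) t = 0
  depth_pos : ∀ t ∈ times T, ∀ x, x₀ t < x → 0 < depth η x t
  smooth_η : ∀ p ∈ wet T x₀, ContDiffAt ℝ 2 (fun q : ℝ × ℝ => η q.1 q.2) p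
  smooth_u : ∀ p ∈ wet T x₀, ContDiffAt ℝ 2 (fun q : ℝ × ℝ => u q.1 q.2) p
  continuity_eq : ∀ p ∈ wet T x₀,
    dt η p.1 p.2 + dx (fun x t => (x + η x t) * u x t) p.1 p.2 = 0
  momentum_eq : ∀ p ∈ wet T x₀,
    dt u p.1 p.2 + u p.1 p.2 * dx u p.1 p.2 + dx η p.1 p.2 = 0

/-- The hodograph coordinate `σ = √(x + η)`. -/
def cgσ (η : ℝ → ℝ → ℝ) (x t : ℝ) : ℝ := Real.sqrt (depth η x t)

/-- The hodograph coordinate `τ = (t - u) / 2`. -/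
def cgτ (u : ℝ → ℝ → ℝ) (x t : ℝ) : ℝ := (t - u x t) / 2

/-- The Jacobian determinant `∂(f, g) / ∂(x, t)`. -/
def jac (f g : ℝ → ℝ → ℝ) (x t : ℝ) : ℝ := dx f x t * dt g x t - dt f x t * dx g x t

/-- The wave does not break: the Carrier–Greenspan map `(x, t) ↦ (σ, τ)` has non-zero Jacobian
off the shoreline. On the shoreline, where the square root `σ` is not differentiable, the
condition is imposed on `(σ², τ)`, whose Jacobian is `2σ` times that of `(σ, τ)`. -/
structure NoBreaking (T : EReal) (η u : ℝ → ℝ → ℝ) (x₀ : ℝ → ℝ) : Prop where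
  interior : ∀ t ∈ times T, ∀ x, x₀ t < x → jac (cgσ η) (cgτ u) x t ≠ 0
  shore : ∀ t ∈ times T, jac (depth η) (cgτ u) (x₀ t) t ≠ 0

/-- The shoreline velocity `v₀ = dx₀/dt` (one-sided at `t = 0`). -/
def shoreVel (x₀ : ℝ → ℝ) (t : ℝ) : ℝ := derivWithin x₀ (Set.Ici 0) t

/-- The delayed time at the shoreline, `(t - v₀(t)) / 2`. -/
def shoreτ (x₀ : ℝ → ℝ) (t : ℝ) : ℝ := (t - shoreVel x₀ t) / 2

/-- The set of values of the delayed time `τ` observed at the shoreline during `[0, T)`. -/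
def observed (T : EReal) (x₀ : ℝ → ℝ) : Set ℝ := shoreτ x₀ '' times T

/-- The function `Ψ`, computed from the shoreline motion only:
`Ψ(τ) = -x₀(t) + v₀(t)² / 2`, where `t ∈ [0, T)` solves `τ = (t - v₀(t)) / 2`. -/
def shoreΨ (T : EReal) (x₀ : ℝ → ℝ) (τ : ℝ) : ℝ :=
  -x₀ (Function.invFunOn (shoreτ x₀) (times T) τ)
    + shoreVel x₀ (Function.invFunOn (shoreτ x₀) (times T) τ) ^ 2 / 2

/-- The Abel transform. -/
def abel (f : ℝ → ℝ) (x : ℝ) : ℝ := ∫ s in (0 : ℝ)..x, f s / Real.sqrt (x ^ 2 - s ^ 2)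

/-- `γ(σ)` is the solution `x ≥ a` of `x + η₀(x) = σ²`, where `a` is the initial shoreline. -/
def initγ (a : ℝ) (η₀ : ℝ → ℝ) (σ : ℝ) : ℝ :=
  Function.invFunOn (fun x => x + η₀ x) (Set.Ici a) (σ ^ 2)

/-- `ψ₀(σ) = η₀(γ(σ))`: the initial data in the hodograph plane for zero initial velocity. -/
def initψ (a : ℝ) (η₀ : ℝ → ℝ) (σ : ℝ) : ℝ := η₀ (initγ a η₀ σ)

end

end SlopingBeach

/-!
Fix `S` and follow `Q = (S - τ)² - σ²`, which vanishes on the characteristic `τ + σ = S`. For a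
function `f`, the density `f(Q)` carried with velocity `u - (S - τ)` satisfies a balance law whose
source is proportional to `f(Q) - 2 Q f'(Q)`; the root `f(Q) = √Q` is therefore conserved, and in
the proof it is replaced by smooth approximations with source tending to zero. Integrating between
the shoreline, the initial line and this characteristic gives, for `0 = θ(0) ≤ S ≤ θ(t)` and the
initial depth `H`, the identity

  `∫_{H(x) ≤ S²} √(S² - H(x)) dx = ∫₀ᵗ (S - θ(s))₊² ds`.

Differentiating it in `S` expresses `Ψ` by an integral of the initial depth, whose Abel transform
is elementary after exchanging the order of integration. If the wave never breaks, then `θ` cannot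
remain below `√H(b)`: the second `S`-derivative of the left side would stay bounded, whereas that of
the right side at `S = θ(t)` is `2t`.
-/

namespace SlopingBeach

open Set Filter Topology MeasureTheory

section PartialDerivatives

variable {f : ℝ → ℝ → ℝ} {x t : ℝ}

theorem hasFDerivAt_uncurried (h : DifferentiableAt ℝ (fun q : ℝ × ℝ => f q.1 q.2) (x, t)) :
    HasFDerivAt (fun q : ℝ × ℝ => f q.1 q.2)
      (dx f x t • ContinuousLinearMap.fst ℝ ℝ ℝ + dt f x t • ContinuousLinearMap.snd ℝ ℝ ℝ)
      (x, t) := by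
  have hd := h.hasFDerivAt
  have hdx : HasDerivAt (fun y => f y t) (fderiv ℝ (fun q : ℝ × ℝ => f q.1 q.2) (x, t) (1, 0)) x :=
    hd.comp_hasDerivAt (f := fun y => (y, t)) x
      ((hasDerivAt_id x).prodMk (hasDerivAt_const x t))
  have hdt : HasDerivAt (fun r => f x r) (fderiv ℝ (fun q : ℝ × ℝ => f q.1 q.2) (x, t) (0, 1)) t :=
    hd.comp_hasDerivAt (f := fun r => (x, r)) t
      ((hasDerivAt_const t x).prodMk (hasDerivAt_id t))
  refine hd.congr_fderiv ?_
  ext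
  · simp [dx, hdx.deriv]
  · simp [dt, hdt.deriv]

theorem hasDerivWithinAt_along {X Y : ℝ → ℝ} {X' Y' r : ℝ} {s : Set ℝ}
    (h : DifferentiableAt ℝ (fun q : ℝ × ℝ => f q.1 q.2) (X r, Y r))
    (hX : HasDerivWithinAt X X' s r) (hY : HasDerivWithinAt Y Y' s r) :
    HasDerivWithinAt (fun r => f (X r) (Y r)) (dx f (X r) (Y r) * X' + dt f (X r) (Y r) * Y')
      s r :=
  ((hasFDerivAt_uncurried h).comp_hasDerivWithinAt (f := fun r => (X r, Y r)) r
    (hX.prodMk hY)).congr_deriv (by simp)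

theorem hasDerivAt_dx (h : DifferentiableAt ℝ (fun q : ℝ × ℝ => f q.1 q.2) (x, t)) :
    HasDerivAt (fun y => f y t) (dx f x t) x :=
  (h.comp (f := fun y => (y, t)) x (by fun_prop)).hasDerivAt

theorem contDiffAt_dx {m n : WithTop ℕ∞} (h : ContDiffAt ℝ n (fun q : ℝ × ℝ => f q.1 q.2) (x, t))
    (hmn : m + 1 ≤ n) : ContDiffAt ℝ m (fun q : ℝ × ℝ => dx f q.1 q.2) (x, t) := by
  refine ((h.fderiv_right hmn).clm_apply
    (contDiffAt_const (c := ((1 : ℝ), (0 : ℝ))))).congr_of_eventuallyEq ?_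
  filter_upwards [(h.of_le (le_add_self.trans hmn)).eventually (by simp)] with q hq
  have hf := hasFDerivAt_uncurried (x := q.1) (t := q.2) (hq.differentiableAt one_ne_zero)
  simp [hf.fderiv]

/- With `X = X r - X t` and `d = r - t`, the error `e` of the linear approximation is `o(X, d)`.
Since `(X, d) - (e, 0) = (-(B / A) d, d)`, also `(X, d) = O(d)`, so that `e = o(d)`. -/
theorem hasDerivWithinAt_of_level {X : ℝ → ℝ} {s : Set ℝ} {A B c : ℝ}
    (hf : HasFDerivAt (fun q : ℝ × ℝ => f q.1 q.2)
      (A • ContinuousLinearMap.fst ℝ ℝ ℝ + B • ContinuousLinearMap.snd ℝ ℝ ℝ) (X t, t))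
    (hA : A ≠ 0) (hX : ContinuousWithinAt X s t) (hs : ∀ r ∈ s, f (X r) r = c)
    (ht : f (X t) t = c) : HasDerivWithinAt X (-B / A) s t := by
  have hpath : Tendsto (fun r => (X r, r)) (𝓝[s] t) (𝓝 (X t, t)) :=
    hX.prodMk_nhds (tendsto_id.mono_left nhdsWithin_le_nhds)
  have herror : (fun r => X r - X t + B / A * (r - t)) =o[𝓝[s] t]
      fun r => (X r - X t, r - t) := by
    refine ((hf.isLittleO.comp_tendsto hpath).const_mul_left (-A⁻¹)).congr' ?_ .rfl
    filter_upwards [self_mem_nhdsWithin] with r hr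
    simp only [ht, add_apply, smul_apply, ContinuousLinearMap.coe_fst', Prod.fst_sub, smul_eq_mul,
      ContinuousLinearMap.coe_snd', Prod.snd_sub, Function.comp_apply, hs r hr, sub_self, zero_sub,
      neg_add_rev, neg_mul]
    field_simp
    ring
  have hbig : (fun r => (X r - X t, r - t)) =O[𝓝[s] t] fun r => r - t := by
    have hlinear := ((Asymptotics.isBigO_refl (fun r => r - t) (𝓝[s] t)).const_mul_left
      (-(B / A))).prod_left (Asymptotics.isBigO_refl (fun r => r - t) (𝓝[s] t))
    refine (herror.prod_left (Asymptotics.isLittleO_zero (E' := ℝ) _ _)).right_isBigO_sub.trans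
      (hlinear.congr_left fun r => ?_)
    simp
  rw [hasDerivWithinAt_iff_isLittleO]
  exact (herror.trans_isBigO hbig).congr_left fun r => by simp only [smul_eq_mul]; ring

end PartialDerivatives

section Times

variable {T : EReal} {r t : ℝ}

theorem times_of_le (ht : t ∈ times T) (h0 : 0 ≤ r) (hr : r ≤ t) : r ∈ times T :=
  ⟨h0, lt_of_le_of_lt (by exact_mod_cast hr) ht.2⟩

theorem Icc_subset_times (ht : t ∈ times T) : Icc 0 t ⊆ times T :=
  fun _ hr => times_of_le ht hr.1 hr.2

theorem ordConnected_times : (times T).OrdConnected :=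
  ⟨fun _ ha _ hb _ hc => times_of_le hb (ha.1.trans hc.1) hc.2⟩

theorem times_mem_nhdsWithin (ht : t ∈ times T) : times T ∈ 𝓝[Ici 0] t := by
  have hT : {r : ℝ | (r : EReal) < T} ∈ 𝓝 t :=
    (isOpen_lt continuous_coe_real_ereal continuous_const).mem_nhds ht.2
  filter_upwards [self_mem_nhdsWithin, mem_nhdsWithin_of_mem_nhds hT] with r h0 h using ⟨h0, h⟩

end Times

/-- The functions `σ + s τ` of the flow, whose case `s = ± 1` gives, up to sign, the Riemann
invariants of the shallow water equations. -/
noncomputable def riemann (s : ℝ) (η u : ℝ → ℝ → ℝ) (x t : ℝ) : ℝ := cgσ η x t + s * cgτ u x t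

namespace IsFlow

variable {T : EReal} {η u : ℝ → ℝ → ℝ} {x₀ : ℝ → ℝ} {x t : ℝ}

theorem depth_nonneg (hflow : IsFlow T η u x₀) (ht : t ∈ times T) (hx : x₀ t ≤ x) :
    0 ≤ depth η x t :=
  hx.eq_or_lt.elim (fun h => h ▸ (hflow.shore_eq t ht).ge) fun h => (hflow.depth_pos t ht x h).le

theorem cgσ_sq (hflow : IsFlow T η u x₀) (ht : t ∈ times T) (hx : x₀ t ≤ x) :
    cgσ η x t ^ 2 = depth η x t :=
  Real.sq_sqrt (hflow.depth_nonneg ht hx)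

theorem cgσ_pos (hflow : IsFlow T η u x₀) (ht : t ∈ times T) (hx : x₀ t < x) : 0 < cgσ η x t :=
  Real.sqrt_pos.2 (hflow.depth_pos t ht x hx)

theorem cgσ_shore (hflow : IsFlow T η u x₀) (ht : t ∈ times T) : cgσ η (x₀ t) t = 0 := by
  rw [cgσ, hflow.shore_eq t ht, Real.sqrt_zero]

theorem contDiffAt_η (hflow : IsFlow T η u x₀) (ht : t ∈ times T) (hx : x₀ t ≤ x) :
    ContDiffAt ℝ 2 (fun q : ℝ × ℝ => η q.1 q.2) (x, t) := hflow.smooth_η (x, t) ⟨ht, hx⟩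

theorem contDiffAt_u (hflow : IsFlow T η u x₀) (ht : t ∈ times T) (hx : x₀ t ≤ x) :
    ContDiffAt ℝ 2 (fun q : ℝ × ℝ => u q.1 q.2) (x, t) := hflow.smooth_u (x, t) ⟨ht, hx⟩

theorem differentiableAt_η (hflow : IsFlow T η u x₀) (ht : t ∈ times T) (hx : x₀ t ≤ x) :
    DifferentiableAt ℝ (fun q : ℝ × ℝ => η q.1 q.2) (x, t) :=
  (hflow.contDiffAt_η ht hx).differentiableAt two_ne_zero

theorem differentiableAt_u (hflow : IsFlow T η u x₀) (ht : t ∈ times T) (hx : x₀ t ≤ x) :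
    DifferentiableAt ℝ (fun q : ℝ × ℝ => u q.1 q.2) (x, t) :=
  (hflow.contDiffAt_u ht hx).differentiableAt two_ne_zero

theorem dt_η_eq (hflow : IsFlow T η u x₀) (ht : t ∈ times T) (hx : x₀ t ≤ x) :
    dt η x t = -(u x t * (1 + dx η x t) + depth η x t * dx u x t) := by
  have hflux : dx (fun x t => (x + η x t) * u x t) x t
      = (1 + dx η x t) * u x t + (x + η x t) * dx u x t :=
    (((hasDerivAt_id x).add (hasDerivAt_dx (hflow.differentiableAt_η ht hx))).mul
      (hasDerivAt_dx (hflow.differentiableAt_u ht hx))).deriv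
  rw [depth]
  linear_combination hflow.continuity_eq (x, t) ⟨ht, hx⟩ - hflux

theorem dt_u_eq (hflow : IsFlow T η u x₀) (ht : t ∈ times T) (hx : x₀ t ≤ x) :
    dt u x t = -(u x t * dx u x t) - dx η x t := by
  linear_combination hflow.momentum_eq (x, t) ⟨ht, hx⟩

section Along

variable {X Y : ℝ → ℝ} {X' Y' r : ℝ} {A : Set ℝ}

theorem hasDerivWithinAt_depth_along (hflow : IsFlow T η u x₀) (ht : Y r ∈ times T)
    (hx : x₀ (Y r) ≤ X r) (hX : HasDerivWithinAt X X' A r) (hY : HasDerivWithinAt Y Y' A r) :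
    HasDerivWithinAt (fun r => depth η (X r) (Y r))
      ((1 + dx η (X r) (Y r)) * (X' - u (X r) (Y r) * Y')
        - depth η (X r) (Y r) * dx u (X r) (Y r) * Y') A r := by
  refine (hX.add (hasDerivWithinAt_along (hflow.differentiableAt_η ht hx) hX hY)).congr_deriv ?_
  rw [hflow.dt_η_eq ht hx]
  ring

theorem hasDerivWithinAt_cgτ_along (hflow : IsFlow T η u x₀) (ht : Y r ∈ times T)
    (hx : x₀ (Y r) ≤ X r) (hX : HasDerivWithinAt X X' A r) (hY : HasDerivWithinAt Y Y' A r) :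
    HasDerivWithinAt (fun r => cgτ u (X r) (Y r))
      (((1 + dx η (X r) (Y r)) * Y' - dx u (X r) (Y r) * (X' - u (X r) (Y r) * Y')) / 2) A r := by
  refine ((hY.sub (hasDerivWithinAt_along (hflow.differentiableAt_u ht hx) hX hY)).div_const
    2).congr_deriv ?_
  rw [hflow.dt_u_eq ht hx]
  ring

theorem hasDerivWithinAt_riemann_along (hflow : IsFlow T η u x₀) {s : ℝ} (hs : s ^ 2 = 1)
    (ht : Y r ∈ times T) (hx : x₀ (Y r) < X r) (hX : HasDerivWithinAt X X' A r)
    (hY : HasDerivWithinAt Y Y' A r) :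
    HasDerivWithinAt (fun r => riemann s η u (X r) (Y r))
      ((X' - (u (X r) (Y r) - s * cgσ η (X r) (Y r)) * Y')
        * (1 + dx η (X r) (Y r) - s * (cgσ η (X r) (Y r) * dx u (X r) (Y r)))
        / (2 * cgσ η (X r) (Y r))) A r := by
  have hσ := hflow.cgσ_pos ht hx
  refine (((hflow.hasDerivWithinAt_depth_along ht hx.le hX hY).sqrt
    (hflow.depth_pos _ ht _ hx).ne').add
      ((hflow.hasDerivWithinAt_cgτ_along ht hx.le hX hY).const_mul s)).congr_deriv ?_
  rw [← hflow.cgσ_sq ht hx.le, Real.sqrt_sq hσ.le]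
  field_simp
  linear_combination cgσ η (X r) (Y r) ^ 2 * dx u (X r) (Y r) * Y' * hs

end Along

theorem hasDerivAt_depth (hflow : IsFlow T η u x₀) (ht : t ∈ times T) (hx : x₀ t ≤ x) :
    HasDerivAt (fun y => depth η y t) (1 + dx η x t) x :=
  (hasDerivAt_id x).add (hasDerivAt_dx (hflow.differentiableAt_η ht hx))

theorem jac_depth_cgτ (hflow : IsFlow T η u x₀) (ht : t ∈ times T) (hx : x₀ t ≤ x) :
    jac (depth η) (cgτ u) x t = ((1 + dx η x t) ^ 2 - (cgσ η x t * dx u x t) ^ 2) / 2 := by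
  have hX := hasDerivWithinAt_univ.2 (hasDerivAt_id' x)
  have hX' := hasDerivWithinAt_univ.2 (hasDerivAt_const t x)
  have hY := hasDerivWithinAt_univ.2 (hasDerivAt_id' t)
  have hY' := hasDerivWithinAt_univ.2 (hasDerivAt_const x t)
  have hHx : dx (depth η) x t = _ :=
    (hasDerivWithinAt_univ.1 (hflow.hasDerivWithinAt_depth_along ht hx hX hY')).deriv
  have hHt : dt (depth η) x t = _ :=
    (hasDerivWithinAt_univ.1 (hflow.hasDerivWithinAt_depth_along ht hx hX' hY)).deriv
  have hτx : dx (cgτ u) x t = _ :=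
    (hasDerivWithinAt_univ.1 (hflow.hasDerivWithinAt_cgτ_along ht hx hX hY')).deriv
  have hτt : dt (cgτ u) x t = _ :=
    (hasDerivWithinAt_univ.1 (hflow.hasDerivWithinAt_cgτ_along ht hx hX' hY)).deriv
  rw [jac, hHx, hHt, hτx, hτt, mul_pow, hflow.cgσ_sq ht hx]
  ring

theorem jac_cgσ_cgτ (hflow : IsFlow T η u x₀) (ht : t ∈ times T) (hx : x₀ t < x) :
    jac (cgσ η) (cgτ u) x t = jac (depth η) (cgτ u) x t / (2 * cgσ η x t) := by
  have hH := (hflow.depth_pos t ht x hx).ne'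
  have hσx : dx (cgσ η) x t = dx (depth η) x t / (2 * cgσ η x t) :=
    ((hflow.hasDerivAt_depth ht hx.le).differentiableAt.hasDerivAt.sqrt hH).deriv
  have hσt : dt (cgσ η) x t = dt (depth η) x t / (2 * cgσ η x t) :=
    ((hasDerivWithinAt_univ.1 (hflow.hasDerivWithinAt_depth_along ht hx.le
      (hasDerivWithinAt_univ.2 (hasDerivAt_const t x))
      (hasDerivWithinAt_univ.2 (hasDerivAt_id' t)))).differentiableAt.hasDerivAt.sqrt hH).deriv
  rw [jac, jac, hσx, hσt]
  ring

theorem jac_depth_cgτ_ne_zero (hflow : IsFlow T η u x₀) (hbreak : NoBreaking T η u x₀)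
    (ht : t ∈ times T) (hx : x₀ t ≤ x) : jac (depth η) (cgτ u) x t ≠ 0 := by
  rcases hx.eq_or_lt with rfl | hx
  · exact hbreak.shore t ht
  · have h := hbreak.interior t ht x hx
    rw [hflow.jac_cgσ_cgτ ht hx] at h
    exact (div_ne_zero_iff.1 h).1

theorem slope_shore_pos (hflow : IsFlow T η u x₀) (hbreak : NoBreaking T η u x₀)
    (ht : t ∈ times T) : 0 < 1 + dx η (x₀ t) t := by
  have hne : 1 + dx η (x₀ t) t ≠ 0 := fun h => by
    simpa [hflow.jac_depth_cgτ ht le_rfl, hflow.cgσ_shore ht, h] using hbreak.shore t ht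
  refine lt_of_le_of_ne ?_ hne.symm
  refine ge_of_tendsto ((hasDerivWithinAt_iff_tendsto_slope' self_notMem_Ioi).1
    (hflow.hasDerivAt_depth ht le_rfl).hasDerivWithinAt) ?_
  filter_upwards [self_mem_nhdsWithin] with y (hy : x₀ t < y)
  rw [slope_def_field, hflow.shore_eq t ht, sub_zero]
  exact div_nonneg (hflow.depth_pos t ht y hy).le (sub_pos.2 hy).le

theorem continuousAt_dx_η (hflow : IsFlow T η u x₀) (ht : t ∈ times T) (hx : x₀ t ≤ x) :
    ContinuousAt (fun q : ℝ × ℝ => dx η q.1 q.2) (x, t) :=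
  (contDiffAt_dx (m := 1) (hflow.contDiffAt_η ht hx) one_add_one_eq_two.le).continuousAt

theorem continuousAt_dx_u (hflow : IsFlow T η u x₀) (ht : t ∈ times T) (hx : x₀ t ≤ x) :
    ContinuousAt (fun q : ℝ × ℝ => dx u q.1 q.2) (x, t) :=
  (contDiffAt_dx (m := 1) (hflow.contDiffAt_u ht hx) one_add_one_eq_two.le).continuousAt

theorem abs_cgσ_mul_dx_u_lt_slope (hflow : IsFlow T η u x₀) (hbreak : NoBreaking T η u x₀)
    (ht : t ∈ times T) (hx : x₀ t ≤ x) : |cgσ η x t * dx u x t| < 1 + dx η x t := by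
  by_contra! hcon
  have hcont : ContinuousOn (fun y => 1 + dx η y t - |cgσ η y t * dx u y t|) (Icc (x₀ t) x) :=
    fun y hy => by
      have hη := (hflow.continuousAt_dx_η ht hy.1).comp (f := fun y => (y, t)) (by fun_prop)
      have hu := (hflow.continuousAt_dx_u ht hy.1).comp (f := fun y => (y, t)) (by fun_prop)
      have hσ := (hflow.hasDerivAt_depth ht hy.1).continuousAt.sqrt
      exact ((hη.const_add 1).sub (hσ.mul hu).abs).continuousWithinAt
  obtain ⟨y, hy, hzero⟩ := intermediate_value_Icc' hx hcont (show (0 : ℝ) ∈ Icc _ _ from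
    ⟨sub_nonpos.2 hcon, by simpa [hflow.cgσ_shore ht] using (hflow.slope_shore_pos hbreak ht).le⟩)
  refine hflow.jac_depth_cgτ_ne_zero hbreak ht hy.1 ?_
  rw [hflow.jac_depth_cgτ ht hy.1, sub_eq_zero.1 hzero, sq_abs, sub_self, zero_div]

theorem slope_pos (hflow : IsFlow T η u x₀) (hbreak : NoBreaking T η u x₀)
    (ht : t ∈ times T) (hx : x₀ t ≤ x) : 0 < 1 + dx η x t :=
  (abs_nonneg _).trans_lt (hflow.abs_cgσ_mul_dx_u_lt_slope hbreak ht hx)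

theorem strictMonoOn_depth (hflow : IsFlow T η u x₀) (hbreak : NoBreaking T η u x₀)
    (ht : t ∈ times T) : StrictMonoOn (fun x => depth η x t) (Ici (x₀ t)) := by
  refine strictMonoOn_of_hasDerivWithinAt_pos (f' := fun y => 1 + dx η y t) (convex_Ici _)
    (fun y hy => (hflow.hasDerivAt_depth ht hy).continuousAt.continuousWithinAt)
    (fun y hy => (hflow.hasDerivAt_depth ht (interior_subset hy)).hasDerivWithinAt) fun y hy => ?_
  exact hflow.slope_pos hbreak ht (interior_subset hy)

theorem strictMonoOn_riemann (hflow : IsFlow T η u x₀) (hbreak : NoBreaking T η u x₀)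
    (ht : t ∈ times T) {s : ℝ} (hs : s ^ 2 = 1) :
    StrictMonoOn (fun x => riemann s η u x t) (Ici (x₀ t)) := by
  have habs : |s| = 1 := by rwa [← sq_eq_sq₀ (abs_nonneg s) zero_le_one, sq_abs, one_pow]
  refine strictMonoOn_of_hasDerivWithinAt_pos (convex_Ici _)
    (fun y hy => ((hflow.hasDerivAt_depth ht hy).continuousAt.sqrt.add
      ((hasDerivAt_dx (hflow.differentiableAt_u ht hy)).continuousAt.const_sub t
        |>.div_const 2 |>.const_mul s)).continuousWithinAt)
    (fun y hy => hflow.hasDerivWithinAt_riemann_along hs ht (by simpa using hy)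
      (hasDerivWithinAt_id y _) (hasDerivWithinAt_const y _ t)) fun y hy => ?_
  have hy' : x₀ t < y := by simpa using hy
  have hslope := hflow.abs_cgσ_mul_dx_u_lt_slope hbreak ht hy'.le
  have hle := le_abs_self (s * (cgσ η y t * dx u y t))
  rw [abs_mul, habs, one_mul] at hle
  rw [mul_zero, sub_zero, one_mul]
  exact div_pos (by linarith) (mul_pos two_pos (hflow.cgσ_pos ht hy'))

theorem hasDerivWithinAt_shore (hflow : IsFlow T η u x₀) (hbreak : NoBreaking T η u x₀)
    (ht : t ∈ times T) : HasDerivWithinAt x₀ (u (x₀ t) t) (Ici 0) t := by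
  have hdepth : HasFDerivAt (fun q : ℝ × ℝ => depth η q.1 q.2)
      ((1 + dx η (x₀ t) t) • ContinuousLinearMap.fst ℝ ℝ ℝ
        + dt η (x₀ t) t • ContinuousLinearMap.snd ℝ ℝ ℝ) (x₀ t, t) := by
    refine (hasFDerivAt_fst.add
      (hasFDerivAt_uncurried (hflow.differentiableAt_η ht le_rfl))).congr_fderiv ?_
    ext <;> simp
  have hslope := (hflow.slope_shore_pos hbreak ht).ne'
  refine ((hasDerivWithinAt_of_level hdepth hslope (hflow.shore_cont t ht) hflow.shore_eq
    (hflow.shore_eq t ht)).mono_of_mem_nhdsWithin (times_mem_nhdsWithin ht)).congr_deriv ?_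
  rw [hflow.dt_η_eq ht le_rfl, hflow.shore_eq t ht]
  field_simp
  ring

theorem shoreVel_eq (hflow : IsFlow T η u x₀) (hbreak : NoBreaking T η u x₀)
    (ht : t ∈ times T) : shoreVel x₀ t = u (x₀ t) t :=
  (hflow.hasDerivWithinAt_shore hbreak ht).derivWithin (uniqueDiffOn_Ici 0 t ht.1)

theorem shoreτ_eq (hflow : IsFlow T η u x₀) (hbreak : NoBreaking T η u x₀)
    (ht : t ∈ times T) : shoreτ x₀ t = cgτ u (x₀ t) t := by
  rw [shoreτ, cgτ, hflow.shoreVel_eq hbreak ht]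

theorem hasDerivWithinAt_shoreτ (hflow : IsFlow T η u x₀) (hbreak : NoBreaking T η u x₀)
    (ht : t ∈ times T) :
    HasDerivWithinAt (shoreτ x₀) ((1 + dx η (x₀ t) t) / 2) (times T) t := by
  refine ((hflow.hasDerivWithinAt_cgτ_along ht le_rfl (hflow.hasDerivWithinAt_shore hbreak ht)
    (hasDerivWithinAt_id t _)).congr_deriv ?_).mono (fun r hr => hr.1) |>.congr
      (fun r hr => hflow.shoreτ_eq hbreak hr) (hflow.shoreτ_eq hbreak ht)
  simp

theorem continuousOn_shoreτ (hflow : IsFlow T η u x₀) (hbreak : NoBreaking T η u x₀) :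
    ContinuousOn (shoreτ x₀) (times T) :=
  fun _ ht => (hflow.hasDerivWithinAt_shoreτ hbreak ht).continuousWithinAt

theorem strictMonoOn_shoreτ (hflow : IsFlow T η u x₀) (hbreak : NoBreaking T η u x₀) :
    StrictMonoOn (shoreτ x₀) (times T) :=
  strictMonoOn_of_hasDerivWithinAt_pos ordConnected_times.convex
    (hflow.continuousOn_shoreτ hbreak)
    (fun _ ht => (hflow.hasDerivWithinAt_shoreτ hbreak (interior_subset ht)).mono interior_subset)
    fun _ ht => half_pos (hflow.slope_shore_pos hbreak (interior_subset ht))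

theorem ordConnected_observed (hflow : IsFlow T η u x₀) (hbreak : NoBreaking T η u x₀) :
    (observed T x₀).OrdConnected :=
  (ordConnected_times.isPreconnected.image _ (hflow.continuousOn_shoreτ hbreak)).ordConnected

theorem shoreΨ_shoreτ (hflow : IsFlow T η u x₀) (hbreak : NoBreaking T η u x₀)
    (ht : t ∈ times T) :
    shoreΨ T x₀ (shoreτ x₀ t) = -x₀ t + shoreVel x₀ t ^ 2 / 2 := by
  rw [shoreΨ, (hflow.strictMonoOn_shoreτ hbreak).injOn.leftInvOn_invFunOn ht]

theorem shoreτ_zero (hflow : IsFlow T η u x₀) (hbreak : NoBreaking T η u x₀)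
    (hT : 0 < T) (hu₀ : u (x₀ 0) 0 = 0) : shoreτ x₀ 0 = 0 := by
  rw [hflow.shoreτ_eq hbreak ⟨le_rfl, hT⟩, cgτ, hu₀, sub_zero, zero_div]

theorem shoreτ_nonneg (hflow : IsFlow T η u x₀) (hbreak : NoBreaking T η u x₀)
    (hu₀ : u (x₀ 0) 0 = 0) (ht : t ∈ times T) : 0 ≤ shoreτ x₀ t := by
  have h0 := times_of_le ht le_rfl ht.1
  rw [← hflow.shoreτ_zero hbreak h0.2 hu₀]
  exact (hflow.strictMonoOn_shoreτ hbreak).monotoneOn h0 ht ht.1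

/- The line recedes, backwards in time, faster than the characteristics on which `σ + τ` equals its
final shoreline value `S`: there `u - σ = t + σ - 2 S`. -/
theorem shoreτ_le_riemann_on_line (hflow : IsFlow T η u x₀) (hbreak : NoBreaking T η u x₀)
    {t₁ m c r : ℝ} (ht₁ : t₁ ∈ times T) (hm : ∀ t ∈ Icc 0 t₁, x₀ t < m) (hc₀ : 0 ≤ c)
    (hc : 2 * shoreτ x₀ t₁ ≤ c) (hr : r ∈ Icc 0 t₁) :
    shoreτ x₀ t₁ ≤ riemann 1 η u (m + c * r) (t₁ - r) := by
  have htime : ∀ r ∈ Icc 0 t₁, t₁ - r ∈ Icc 0 t₁ := fun r hr => ⟨sub_nonneg.2 hr.2, by grind⟩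
  have hwet : ∀ r ∈ Icc 0 t₁, x₀ (t₁ - r) < m + c * r := fun r hr =>
    (hm _ (htime r hr)).trans_le (le_add_of_nonneg_right (mul_nonneg hc₀ hr.1))
  have hderiv (r) (hr : r ∈ Icc 0 t₁) (A : Set ℝ) :=
    hflow.hasDerivWithinAt_riemann_along (one_pow 2) (Icc_subset_times ht₁ (htime r hr))
      (hwet r hr) (((hasDerivWithinAt_id r A).const_mul c).const_add m)
      ((hasDerivWithinAt_id r A).const_sub t₁)
  refine image_le_of_deriv_right_lt_deriv_boundary' (f := fun _ => shoreτ x₀ t₁) (f' := fun _ => 0)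
    continuousOn_const (fun r _ => hasDerivWithinAt_const r _ _) ?_
    (fun r hr => (hderiv r hr _).continuousWithinAt)
    (fun r hr => hderiv r (Ico_subset_Icc_self hr) _) (fun r hr hSr => ?_) hr
  · have hfirst : x₀ t₁ < m + c * 0 := by simpa using hwet 0 ⟨le_rfl, ht₁.1⟩
    have hle := (hflow.strictMonoOn_riemann hbreak ht₁ (one_pow 2)).monotoneOn
      (mem_Ici.2 le_rfl) hfirst.le hfirst.le
    simpa [riemann, hflow.cgσ_shore ht₁, ← hflow.shoreτ_eq hbreak ht₁] using hle
  · have hr' := Ico_subset_Icc_self hr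
    have hT := Icc_subset_times ht₁ (htime r hr')
    have hσ := hflow.cgσ_pos hT (hwet r hr')
    have hslope := hflow.abs_cgσ_mul_dx_u_lt_slope hbreak hT (hwet r hr').le
    simp only [riemann, cgτ, id_eq] at hSr
    refine div_pos (mul_pos ?_ ?_) (mul_pos two_pos hσ)
    · simp only [id_eq]
      linarith [hr.2]
    · rw [one_mul, sub_pos]
      exact (le_abs_self _).trans_lt hslope

theorem exists_shoreτ_le_riemann (hflow : IsFlow T η u x₀) (hbreak : NoBreaking T η u x₀)
    {t₁ : ℝ} (ht₁ : t₁ ∈ times T) :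
    ∃ L, ∀ t ∈ Icc 0 t₁, x₀ t ≤ L ∧ ∀ x, L ≤ x → shoreτ x₀ t₁ ≤ riemann 1 η u x t := by
  obtain ⟨m, hm⟩ := (isCompact_Icc.image_of_continuousOn
    (hflow.shore_cont.mono (Icc_subset_times ht₁))).bddAbove
  have hshore : ∀ t ∈ Icc 0 t₁, x₀ t < m + 1 := fun t ht =>
    (hm (mem_image_of_mem x₀ ht)).trans_lt (lt_add_one m)
  set c : ℝ := 2 * |shoreτ x₀ t₁|
  have hc₀ : 0 ≤ c := by positivity
  refine ⟨m + 1 + c * t₁, fun t ht => ?_⟩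
  have hline := hflow.shoreτ_le_riemann_on_line hbreak ht₁ hshore hc₀
    (mul_le_mul_of_nonneg_left (le_abs_self _) zero_le_two)
    (r := t₁ - t) ⟨sub_nonneg.2 ht.2, by grind⟩
  rw [sub_sub_cancel] at hline
  have hwet : x₀ t ≤ m + 1 + c * (t₁ - t) :=
    (hshore t ht).le.trans (le_add_of_nonneg_right (mul_nonneg hc₀ (sub_nonneg.2 ht.2)))
  have hL : m + 1 + c * (t₁ - t) ≤ m + 1 + c * t₁ := by nlinarith [ht.1]
  exact ⟨hwet.trans hL, fun x hx => hline.trans <|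
    (hflow.strictMonoOn_riemann hbreak (Icc_subset_times ht₁ ht) (one_pow 2)).monotoneOn
      hwet (hwet.trans (hL.trans hx)) (hL.trans hx)⟩

theorem sq_shoreτ_sub_cgτ_le_depth (hflow : IsFlow T η u x₀) (hbreak : NoBreaking T η u x₀)
    {t₁ : ℝ} (ht₁ : t₁ ∈ times T) (ht : t ∈ Icc 0 t₁) (hx : x₀ t ≤ x)
    (hS : shoreτ x₀ t₁ ≤ riemann 1 η u x t) :
    (shoreτ x₀ t₁ - cgτ u x t) ^ 2 ≤ depth η x t := by
  have htT := Icc_subset_times ht₁ ht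
  have hminus : riemann (-1) η u (x₀ t) t ≤ riemann (-1) η u x t :=
    (hflow.strictMonoOn_riemann hbreak htT (by norm_num)).monotoneOn (mem_Ici.2 le_rfl) hx hx
  have hτ := (hflow.strictMonoOn_shoreτ hbreak).monotoneOn htT ht₁ ht.2
  rw [hflow.shoreτ_eq hbreak htT] at hτ
  simp only [riemann, hflow.cgσ_shore htT] at hminus hS
  rw [← hflow.cgσ_sq htT hx]
  exact sq_le_sq' (by linarith) (by linarith)

theorem exists_sq_shoreτ_le_depth (hflow : IsFlow T η u x₀) (hbreak : NoBreaking T η u x₀)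
    (hu₀ : ∀ x, x₀ 0 ≤ x → u x 0 = 0) {t₁ : ℝ} (ht₁ : t₁ ∈ times T) :
    ∃ x, x₀ 0 ≤ x ∧ shoreτ x₀ t₁ ^ 2 ≤ depth η x 0 := by
  obtain ⟨L, hL⟩ := hflow.exists_shoreτ_le_riemann hbreak ht₁
  obtain ⟨hwet, hright⟩ := hL 0 ⟨le_rfl, ht₁.1⟩
  have h := hflow.sq_shoreτ_sub_cgτ_le_depth hbreak ht₁ ⟨le_rfl, ht₁.1⟩ hwet (hright L le_rfl)
  rw [cgτ, hu₀ L hwet, sub_zero, zero_div, sub_zero] at h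
  exact ⟨L, hwet, h⟩

end IsFlow

theorem integral_divergence_of_continuousOn {F G s : ℝ × ℝ → ℝ} {F' G' : ℝ × ℝ → ℝ × ℝ →L[ℝ] ℝ}
    {a b : ℝ} (ha : 0 ≤ a) (hb : 0 ≤ b) (hF : ContinuousOn F (Icc 0 a ×ˢ Icc 0 b))
    (hG : ContinuousOn G (Icc 0 a ×ˢ Icc 0 b)) (hs : ContinuousOn s (Icc 0 a ×ˢ Icc 0 b))
    (hF' : ∀ p ∈ Ioo 0 a ×ˢ Ioo 0 b, HasFDerivAt F (F' p) p)
    (hG' : ∀ p ∈ Ioo 0 a ×ˢ Ioo 0 b, HasFDerivAt G (G' p) p)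
    (hdiv : ∀ p ∈ Icc 0 a ×ˢ Icc 0 b, F' p (1, 0) + G' p (0, 1) = s p) :
    (∫ z in (0 : ℝ)..a, ∫ t in (0 : ℝ)..b, s (z, t))
      = (((∫ z in (0 : ℝ)..a, G (z, b)) - ∫ z in (0 : ℝ)..a, G (z, 0))
        + ∫ t in (0 : ℝ)..b, F (a, t)) - ∫ t in (0 : ℝ)..b, F (0, t) := by
  refine (intervalIntegral.integral_congr fun z hz => intervalIntegral.integral_congr
    fun t ht => ?_).trans <| integral2_divergence_prod_of_hasFDerivAt_off_countable
      F G F' G' 0 0 a b ∅ countable_empty ?_ ?_ ?_ ?_ ?_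
  · rw [uIcc_of_le ha] at hz
    rw [uIcc_of_le hb] at ht
    exact (hdiv (z, t) ⟨hz, ht⟩).symm
  all_goals simp only [uIcc_of_le, min_eq_left, max_eq_right, sdiff_empty, *]
  · exact hF'
  · exact hG'
  · exact (hs.congr hdiv).integrableOn_compact (isCompact_Icc.prod isCompact_Icc)

section ConservationLaw

/-- The quantity `(S - τ)² - σ²`, positive inside the characteristic `τ + σ = S`. Functions of it
serve as densities of approximate conservation laws. -/
noncomputable def charQ (S : ℝ) (η u : ℝ → ℝ → ℝ) (x t : ℝ) : ℝ :=
  (S - cgτ u x t) ^ 2 - depth η x t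

/-- The transport velocity of `charQ`, equal to the characteristic speed `u - σ` on `τ + σ = S`. -/
noncomputable def charVel (S : ℝ) (u : ℝ → ℝ → ℝ) (x t : ℝ) : ℝ := u x t - (S - cgτ u x t)

namespace IsFlow

variable {T : EReal} {η u : ℝ → ℝ → ℝ} {x₀ : ℝ → ℝ} {S x t t₁ ℓ z : ℝ}

theorem contDiffAt_cgτ (hflow : IsFlow T η u x₀) (ht : t ∈ times T) (hx : x₀ t ≤ x) :
    ContDiffAt ℝ 2 (fun q : ℝ × ℝ => cgτ u q.1 q.2) (x, t) :=
  (contDiffAt_snd.sub (hflow.contDiffAt_u ht hx)).div_const 2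

theorem contDiffAt_charQ (hflow : IsFlow T η u x₀) (ht : t ∈ times T) (hx : x₀ t ≤ x) :
    ContDiffAt ℝ 2 (fun q : ℝ × ℝ => charQ S η u q.1 q.2) (x, t) :=
  ((contDiffAt_const.sub (hflow.contDiffAt_cgτ ht hx)).pow 2).sub
    (contDiffAt_fst.add (hflow.contDiffAt_η ht hx))

theorem contDiffAt_charVel (hflow : IsFlow T η u x₀) (ht : t ∈ times T) (hx : x₀ t ≤ x) :
    ContDiffAt ℝ 2 (fun q : ℝ × ℝ => charVel S u q.1 q.2) (x, t) :=
  (hflow.contDiffAt_u ht hx).sub (contDiffAt_const.sub (hflow.contDiffAt_cgτ ht hx))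

theorem dx_charVel (hflow : IsFlow T η u x₀) (ht : t ∈ times T) (hx : x₀ t ≤ x) :
    dx (charVel S u) x t = dx u x t / 2 := by
  have hu := hasDerivAt_dx (hflow.differentiableAt_u ht hx)
  refine (hu.sub (((hu.const_sub t).div_const 2).const_sub S)).deriv.trans ?_
  ring

theorem dt_charQ_add_charVel_mul_dx_charQ (hflow : IsFlow T η u x₀) (ht : t ∈ times T)
    (hx : x₀ t ≤ x) :
    dt (charQ S η u) x t + charVel S u x t * dx (charQ S η u) x t
      = -(charQ S η u x t * dx u x t) := by
  have hpath {X Y : ℝ → ℝ} {X' Y' r : ℝ} (hX : HasDerivAt X X' r) (hY : HasDerivAt Y Y' r)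
      (hr : Y r ∈ times T) (hx : x₀ (Y r) ≤ X r) :=
    (((hasDerivWithinAt_univ.1 (hflow.hasDerivWithinAt_cgτ_along hr hx
      (hasDerivWithinAt_univ.2 hX) (hasDerivWithinAt_univ.2 hY))).const_sub S).pow 2).sub
    (hasDerivWithinAt_univ.1 (hflow.hasDerivWithinAt_depth_along hr hx
      (hasDerivWithinAt_univ.2 hX) (hasDerivWithinAt_univ.2 hY)))
  have hQx : dx (charQ S η u) x t = _ :=
    (hpath (hasDerivAt_id' x) (hasDerivAt_const x t) ht hx).deriv
  have hQt : dt (charQ S η u) x t = _ :=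
    (hpath (hasDerivAt_const t x) (hasDerivAt_id' t) ht hx).deriv
  rw [hQx, hQt, charVel, charQ]
  ring

theorem continuousOn_frame (hflow : IsFlow T η u x₀) (ht₁ : t₁ ∈ times T) {g : ℝ → ℝ → ℝ}
    (hg : ∀ t ∈ times T, ∀ x, x₀ t ≤ x → ContinuousAt (fun q : ℝ × ℝ => g q.1 q.2) (x, t)) :
    ContinuousOn (fun p : ℝ × ℝ => g (x₀ p.2 + p.1) p.2) (Icc 0 ℓ ×ˢ Icc 0 t₁) := by
  have hframe : ContinuousOn (fun p : ℝ × ℝ => (x₀ p.2 + p.1, p.2)) (Icc 0 ℓ ×ˢ Icc 0 t₁) :=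
    (((hflow.shore_cont.mono (Icc_subset_times ht₁)).comp continuousOn_snd
      fun p hp => hp.2).add continuousOn_fst).prodMk continuousOn_snd
  exact fun p hp => (hg p.2 (Icc_subset_times ht₁ hp.2) _
    (le_add_of_nonneg_right hp.1.1)).comp_continuousWithinAt
      (f := fun p : ℝ × ℝ => (x₀ p.2 + p.1, p.2)) (hframe p hp)

theorem continuousOn_u_shore (hflow : IsFlow T η u x₀) (ht₁ : t₁ ∈ times T) :
    ContinuousOn (fun p : ℝ × ℝ => u (x₀ p.2) p.2) (Icc 0 ℓ ×ˢ Icc 0 t₁) := by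
  have hzero : MapsTo (fun p : ℝ × ℝ => ((0 : ℝ), p.2)) (Icc 0 ℓ ×ˢ Icc 0 t₁)
      (Icc 0 ℓ ×ˢ Icc 0 t₁) := fun p hp => ⟨⟨le_rfl, hp.1.1.trans hp.1.2⟩, hp.2⟩
  simpa [Function.comp_def] using (hflow.continuousOn_frame ht₁
    fun t ht x hx => (hflow.contDiffAt_u ht hx).continuousAt).comp
    (continuousOn_const.prodMk continuousOn_snd) hzero

theorem hasDerivAt_shore (hflow : IsFlow T η u x₀) (hbreak : NoBreaking T η u x₀)
    (ht : t ∈ times T) (h0 : 0 < t) : HasDerivAt x₀ (u (x₀ t) t) t :=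
  (hflow.hasDerivWithinAt_shore hbreak ht).hasDerivAt (Ici_mem_nhds h0)

theorem hasFDerivAt_frame (hflow : IsFlow T η u x₀) (hbreak : NoBreaking T η u x₀)
    (ht : t ∈ times T) (h0 : 0 < t) {g : ℝ → ℝ → ℝ}
    (hg : DifferentiableAt ℝ (fun q : ℝ × ℝ => g q.1 q.2) (x₀ t + z, t)) :
    HasFDerivAt (fun p : ℝ × ℝ => g (x₀ p.2 + p.1) p.2)
      (dx g (x₀ t + z) t • ContinuousLinearMap.fst ℝ ℝ ℝ
        + (dx g (x₀ t + z) t * u (x₀ t) t + dt g (x₀ t + z) t) •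
          ContinuousLinearMap.snd ℝ ℝ ℝ) (z, t) := by
  have hshore : HasFDerivAt (fun p : ℝ × ℝ => x₀ p.2)
      (u (x₀ t) t • ContinuousLinearMap.snd ℝ ℝ ℝ) (z, t) :=
    (hflow.hasDerivAt_shore hbreak ht h0).comp_hasFDerivAt (z, t) hasFDerivAt_snd
  refine ((hasFDerivAt_uncurried hg).comp (f := fun p : ℝ × ℝ => (x₀ p.2 + p.1, p.2)) (z, t)
    ((hshore.add hasFDerivAt_fst).prodMk hasFDerivAt_snd)).congr_fderiv ?_
  ext <;> simp

theorem exists_hasFDerivAt_charVel_sub_u_shore (hflow : IsFlow T η u x₀)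
    (hbreak : NoBreaking T η u x₀) (ht : t ∈ times T) (h0 : 0 < t) (hz : 0 ≤ z) :
    ∃ c : ℝ, HasFDerivAt (fun p : ℝ × ℝ => charVel S u (x₀ p.2 + p.1) p.2 - u (x₀ p.2) p.2)
      ((dx u (x₀ t + z) t / 2) • ContinuousLinearMap.fst ℝ ℝ ℝ
        + c • ContinuousLinearMap.snd ℝ ℝ ℝ) (z, t) := by
  have hwet : x₀ t ≤ x₀ t + z := le_add_of_nonneg_right hz
  have hvel := hflow.hasFDerivAt_frame hbreak ht h0
    ((hflow.contDiffAt_charVel (S := S) ht hwet).differentiableAt two_ne_zero)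
  have hshore : HasFDerivAt (fun p : ℝ × ℝ => u (x₀ p.2) p.2)
      ((dx u (x₀ t) t * u (x₀ t) t + dt u (x₀ t) t * 1) • ContinuousLinearMap.snd ℝ ℝ ℝ) (z, t) :=
    (hasDerivWithinAt_univ.1 (hasDerivWithinAt_along (hflow.differentiableAt_u ht le_rfl)
      (hasDerivWithinAt_univ.2 (hflow.hasDerivAt_shore hbreak ht h0))
      (hasDerivWithinAt_id t univ))).comp_hasFDerivAt (f := Prod.snd) (z, t) hasFDerivAt_snd
  have h := hvel.sub hshore
  rw [hflow.dx_charVel ht hwet, add_sub_assoc, ← sub_smul] at h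
  exact ⟨_, h⟩

theorem integral_balance (hflow : IsFlow T η u x₀) (hbreak : NoBreaking T η u x₀)
    (ht₁ : t₁ ∈ times T) (hℓ : 0 ≤ ℓ) {f f' : ℝ → ℝ} (hf : ∀ y, HasDerivAt f (f' y) y)
    (hf' : Continuous f') :
    (∫ z in (0 : ℝ)..ℓ, ∫ t in (0 : ℝ)..t₁,
      dx u (x₀ t + z) t / 2 * (f (charQ S η u (x₀ t + z) t)
        - 2 * charQ S η u (x₀ t + z) t * f' (charQ S η u (x₀ t + z) t)))
      = (((∫ z in (0 : ℝ)..ℓ, f (charQ S η u (x₀ t₁ + z) t₁))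
        - ∫ z in (0 : ℝ)..ℓ, f (charQ S η u (x₀ 0 + z) 0))
        + ∫ t in (0 : ℝ)..t₁, (charVel S u (x₀ t + ℓ) t - u (x₀ t) t)
            * f (charQ S η u (x₀ t + ℓ) t))
        - ∫ t in (0 : ℝ)..t₁, (charVel S u (x₀ t + 0) t - u (x₀ t) t)
            * f (charQ S η u (x₀ t + 0) t) := by
  have hfc : Continuous f := continuous_iff_continuousAt.2 fun y => (hf y).continuousAt
  have hmem : ∀ p ∈ Ioo 0 ℓ ×ˢ Ioo 0 t₁, p.2 ∈ times T ∧ 0 < p.2 ∧ 0 ≤ p.1 := fun p hp =>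
    ⟨Icc_subset_times ht₁ (Ioo_subset_Icc_self hp.2), hp.2.1, hp.1.1.le⟩
  choose! c hvel using fun p hp => hflow.exists_hasFDerivAt_charVel_sub_u_shore hbreak (S := S)
    (hmem p hp).1 (hmem p hp).2.1 (hmem p hp).2.2
  have hfQ : ∀ p ∈ Ioo 0 ℓ ×ˢ Ioo 0 t₁, HasFDerivAt
      (fun p : ℝ × ℝ => f (charQ S η u (x₀ p.2 + p.1) p.2)) _ p := fun p hp =>
    (hf _).comp_hasFDerivAt p (hflow.hasFDerivAt_frame hbreak (hmem p hp).1 (hmem p hp).2.1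
      ((hflow.contDiffAt_charQ (hmem p hp).1
        (le_add_of_nonneg_right (hmem p hp).2.2)).differentiableAt two_ne_zero))
  have hQ : ContinuousOn (fun p : ℝ × ℝ => charQ S η u (x₀ p.2 + p.1) p.2)
      (Icc 0 ℓ ×ˢ Icc 0 t₁) := hflow.continuousOn_frame ht₁ fun _ ht _ hx =>
    (hflow.contDiffAt_charQ ht hx).continuousAt
  refine integral_divergence_of_continuousOn (s := fun p => dx u (x₀ p.2 + p.1) p.2 / 2
      * (f (charQ S η u (x₀ p.2 + p.1) p.2) - 2 * charQ S η u (x₀ p.2 + p.1) p.2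
        * f' (charQ S η u (x₀ p.2 + p.1) p.2)))
    hℓ ht₁.1 (ContinuousOn.mul ?_ (hfc.comp_continuousOn hQ)) (hfc.comp_continuousOn hQ)
    (ContinuousOn.mul ?_ ((hfc.comp_continuousOn hQ).sub
      ((continuousOn_const.mul hQ).mul (hf'.comp_continuousOn hQ))))
    (fun p hp => (hvel p hp).mul (hfQ p hp)) hfQ fun p hp => ?_
  · exact (hflow.continuousOn_frame ht₁ fun _ ht _ hx =>
      (hflow.contDiffAt_charVel ht hx).continuousAt).sub (hflow.continuousOn_u_shore ht₁)
  · exact (hflow.continuousOn_frame ht₁ fun _ ht _ hx => hflow.continuousAt_dx_u ht hx).div_const 2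
  · have hlaw := hflow.dt_charQ_add_charVel_mul_dx_charQ (S := S)
      (Icc_subset_times ht₁ hp.2) (le_add_of_nonneg_right hp.1.1)
    simp only [smul_add, Prod.mk.eta, Function.comp_apply, add_apply, smul_apply,
      ContinuousLinearMap.coe_fst', smul_eq_mul, mul_one, ContinuousLinearMap.coe_snd', mul_zero,
      add_zero, zero_add]
    linear_combination f' (charQ S η u (x₀ p.2 + p.1) p.2) * hlaw

theorem integral_shore_sub_integral_initial (hflow : IsFlow T η u x₀)
    (hbreak : NoBreaking T η u x₀) (ht₁ : t₁ ∈ times T) (hℓ : 0 ≤ ℓ)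
    (hright : ∀ t ∈ Icc 0 t₁, charQ S η u (x₀ t + ℓ) t ≤ 0)
    (htop : ∀ z ∈ Icc 0 ℓ, charQ S η u (x₀ t₁ + z) t₁ ≤ 0) {f f' : ℝ → ℝ}
    (hf : ∀ y, HasDerivAt f (f' y) y) (hf' : Continuous f') (hf₀ : ∀ y ≤ 0, f y = 0) :
    (∫ t in (0 : ℝ)..t₁, (S - cgτ u (x₀ t) t) * f ((S - cgτ u (x₀ t) t) ^ 2))
      - (∫ z in (0 : ℝ)..ℓ, f (charQ S η u (x₀ 0 + z) 0))
      = ∫ z in (0 : ℝ)..ℓ, ∫ t in (0 : ℝ)..t₁,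
        dx u (x₀ t + z) t / 2 * (f (charQ S η u (x₀ t + z) t)
          - 2 * charQ S η u (x₀ t + z) t * f' (charQ S η u (x₀ t + z) t)) := by
  have htop' : ∫ z in (0 : ℝ)..ℓ, f (charQ S η u (x₀ t₁ + z) t₁) = ∫ _ in (0 : ℝ)..ℓ, 0 :=
    intervalIntegral.integral_congr fun z hz => hf₀ _ (htop z (uIcc_of_le hℓ ▸ hz))
  have hright' : ∫ t in (0 : ℝ)..t₁, (charVel S u (x₀ t + ℓ) t - u (x₀ t) t)
      * f (charQ S η u (x₀ t + ℓ) t) = ∫ _ in (0 : ℝ)..t₁, 0 :=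
    intervalIntegral.integral_congr fun t ht =>
      mul_eq_zero_of_right _ (hf₀ _ (hright t (uIcc_of_le ht₁.1 ▸ ht)))
  have hshore : ∫ t in (0 : ℝ)..t₁, (charVel S u (x₀ t + 0) t - u (x₀ t) t)
      * f (charQ S η u (x₀ t + 0) t)
      = ∫ t in (0 : ℝ)..t₁, -((S - cgτ u (x₀ t) t) * f ((S - cgτ u (x₀ t) t) ^ 2)) :=
    intervalIntegral.integral_congr fun t ht => by
      simp only [add_zero, charVel, charQ, sub_zero,
        hflow.shore_eq t (Icc_subset_times ht₁ (uIcc_of_le ht₁.1 ▸ ht))]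
      ring
  rw [hflow.integral_balance hbreak ht₁ hℓ hf hf', htop', hright', hshore]
  simp only [intervalIntegral.integral_zero, intervalIntegral.integral_neg]
  ring

end IsFlow

end ConservationLaw

section SmoothSqrt

/-- An approximation of the square root within distance `δ`, continuously differentiable and equal
to zero on the negative axis. -/
noncomputable def smoothSqrt (δ y : ℝ) : ℝ := √√(δ ^ 4 + max y 0 ^ 2) - δ

variable {δ : ℝ}

theorem smoothSqrt_add_pow_four (hδ : 0 < δ) (y : ℝ) :
    (smoothSqrt δ y + δ) ^ 4 = δ ^ 4 + max y 0 ^ 2 := by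
  rw [smoothSqrt, sub_add_cancel, pow_mul _ 2 2, Real.sq_sqrt (Real.sqrt_nonneg _),
    Real.sq_sqrt (by positivity)]

theorem smoothSqrt_nonneg (δ y : ℝ) : 0 ≤ smoothSqrt δ y := by
  refine sub_nonneg.2 (Real.le_sqrt_of_sq_le (Real.le_sqrt_of_sq_le ?_))
  nlinarith [sq_nonneg (max y 0)]

theorem smoothSqrt_of_nonpos (hδ : 0 < δ) {y : ℝ} (hy : y ≤ 0) : smoothSqrt δ y = 0 := by
  have h := smoothSqrt_add_pow_four hδ y
  rw [max_eq_right hy, zero_pow two_ne_zero, add_zero,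
    pow_left_inj₀ (by linarith [smoothSqrt_nonneg δ y]) hδ.le four_ne_zero] at h
  linarith

theorem abs_sqrt_sub_smoothSqrt_le (hδ : 0 < δ) (y : ℝ) : |√y - smoothSqrt δ y| ≤ δ := by
  have hroot : √y ^ 4 = max y 0 ^ 2 := by
    rcases le_total y 0 with hy | hy
    · simp [Real.sqrt_eq_zero_of_nonpos hy, hy]
    · rw [pow_mul _ 2 2, Real.sq_sqrt hy, max_eq_left hy]
  have hpow := smoothSqrt_add_pow_four hδ y
  have hnonneg := smoothSqrt_nonneg δ y
  have hlower : √y ≤ smoothSqrt δ y + δ := by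
    refine le_of_pow_le_pow_left₀ four_ne_zero (by positivity) ?_
    rw [hpow, hroot]
    exact le_add_of_nonneg_left (by positivity)
  have hupper : smoothSqrt δ y + δ ≤ √y + δ := by
    refine le_of_pow_le_pow_left₀ four_ne_zero (by positivity) ?_
    rw [hpow, ← hroot, add_comm]
    exact pow_add_pow_le (Real.sqrt_nonneg y) hδ.le four_ne_zero
  exact abs_le.2 ⟨by linarith, by linarith⟩

theorem hasDerivAt_max_zero_sq (y : ℝ) : HasDerivAt (fun y => max y 0 ^ 2) (2 * max y 0) y := by
  rcases lt_trichotomy y 0 with hy | rfl | hy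
  · rw [max_eq_right hy.le, mul_zero]
    refine (hasDerivAt_const y (0 : ℝ)).congr_of_eventuallyEq ?_
    filter_upwards [Iio_mem_nhds hy] with z hz
    rw [max_eq_right (le_of_lt hz), zero_pow two_ne_zero]
  · rw [max_self, mul_zero]
    refine .of_isLittleO ?_
    have hbound : (fun y : ℝ => max y 0 ^ 2) =O[𝓝 0] fun y => y ^ 2 := by
      refine Asymptotics.isBigO_of_le _ fun y => ?_
      rw [norm_pow, norm_pow]
      gcongr
      rcases le_total y 0 with hy | hy <;> simp [hy]
    simpa using hbound.trans_isLittleO (Asymptotics.isLittleO_pow_id one_lt_two)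
  · rw [max_eq_left hy.le]
    refine ((hasDerivAt_pow 2 y).congr_deriv (by simp)).congr_of_eventuallyEq ?_
    filter_upwards [Ioi_mem_nhds hy] with z hz
    rw [max_eq_left (le_of_lt hz)]

theorem hasDerivAt_smoothSqrt (hδ : 0 < δ) (y : ℝ) :
    HasDerivAt (smoothSqrt δ) (max y 0 / (2 * (smoothSqrt δ y + δ) ^ 3)) y := by
  have hw : 0 < δ ^ 4 + max y 0 ^ 2 := by positivity
  refine ((((hasDerivAt_max_zero_sq y).const_add (δ ^ 4)).sqrt hw.ne').sqrt
    (Real.sqrt_pos.2 hw).ne' |>.sub_const δ).congr_deriv ?_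
  have hroot : √(δ ^ 4 + max y 0 ^ 2) = (smoothSqrt δ y + δ) ^ 2 := by
    rw [smoothSqrt, sub_add_cancel, Real.sq_sqrt (Real.sqrt_nonneg _)]
  have hpos : 0 < smoothSqrt δ y + δ := by linarith [smoothSqrt_nonneg δ y]
  rw [hroot, Real.sqrt_sq hpos.le]
  field_simp

theorem continuous_smoothSqrt (hδ : 0 < δ) : Continuous (smoothSqrt δ) :=
  continuous_iff_continuousAt.2 fun y => (hasDerivAt_smoothSqrt hδ y).continuousAt

theorem continuous_deriv_smoothSqrt (hδ : 0 < δ) :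
    Continuous fun y => max y 0 / (2 * (smoothSqrt δ y + δ) ^ 3) := by
  have hcont := continuous_smoothSqrt hδ
  have hpos : ∀ y, 2 * (smoothSqrt δ y + δ) ^ 3 ≠ 0 := fun y => by
    have := smoothSqrt_nonneg δ y
    positivity
  fun_prop (disch := exact hpos _)

theorem abs_smoothSqrt_sub_two_mul_deriv_le (hδ : 0 < δ) (y : ℝ) :
    |smoothSqrt δ y - 2 * y * (max y 0 / (2 * (smoothSqrt δ y + δ) ^ 3))| ≤ δ := by
  have hnonneg := smoothSqrt_nonneg δ y
  have hpow := smoothSqrt_add_pow_four hδ y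
  have hmul : y * max y 0 = max y 0 ^ 2 := by rcases le_total y 0 with hy | hy <;> simp [hy, sq]
  set w := smoothSqrt δ y + δ with hw
  have hδw : δ ≤ w := hw ▸ le_add_of_nonneg_left hnonneg
  have hw₀ : 0 < w := by linarith
  have heq : smoothSqrt δ y - 2 * y * (max y 0 / (2 * w ^ 3)) = δ ^ 4 / w ^ 3 - δ := by
    rw [eq_sub_of_add_eq hw.symm]
    field_simp
    linear_combination hpow - hmul
  have hle : δ ^ 4 / w ^ 3 ≤ δ := by
    rw [div_le_iff₀ (by positivity), pow_succ' δ 3]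
    gcongr
  rw [heq, abs_le]
  constructor <;> linarith [show 0 ≤ δ ^ 4 / w ^ 3 by positivity]

end SmoothSqrt

section ShorelineIdentity

theorem eq_of_forall_abs_sub_le_mul {A B K : ℝ} (h : ∀ δ : ℝ, 0 < δ → |A - B| ≤ K * δ) :
    A = B := by
  have hlim : Tendsto (fun δ : ℝ => K * δ) (𝓝[>] 0) (𝓝 0) := by
    simpa using (continuous_const_mul K).continuousWithinAt.tendsto (x := 0) (s := Ioi 0)
  exact sub_eq_zero.1 <| abs_eq_zero.1 <| le_antisymm
    (ge_of_tendsto hlim (eventually_mem_nhdsWithin.mono h)) (abs_nonneg _)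

theorem abs_integral_sub_integral_le {f g : ℝ → ℝ} {a b C : ℝ} (hab : a ≤ b)
    (hf : ContinuousOn f (Icc a b)) (hg : ContinuousOn g (Icc a b))
    (h : ∀ x ∈ Icc a b, |f x - g x| ≤ C) :
    |(∫ x in a..b, f x) - ∫ x in a..b, g x| ≤ C * (b - a) := by
  rw [← intervalIntegral.integral_sub (hf.intervalIntegrable_of_Icc hab)
    (hg.intervalIntegrable_of_Icc hab), ← abs_of_nonneg (sub_nonneg.2 hab)]
  rw [← Real.norm_eq_abs]
  exact intervalIntegral.norm_integral_le_of_norm_le_const fun x hx =>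
    h x (Ioc_subset_Icc_self (uIoc_of_le hab ▸ hx))

theorem integral_sqrt_const_sub_eq_of_le {H : ℝ → ℝ} {a b c d : ℝ} (hab : a ≤ b) (hbd : b ≤ d)
    (hH : ContinuousOn H (Icc a d)) (hc : ∀ x ∈ Icc b d, c ≤ H x) :
    ∫ x in a..d, √(c - H x) = ∫ x in a..b, √(c - H x) := by
  have hcont : ContinuousOn (fun x => √(c - H x)) (Icc a d) := (continuousOn_const.sub hH).sqrt
  rw [← intervalIntegral.integral_add_adjacent_intervals
      ((hcont.mono (Icc_subset_Icc_right hbd)).intervalIntegrable_of_Icc hab)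
      ((hcont.mono (Icc_subset_Icc_left hab)).intervalIntegrable_of_Icc hbd),
    intervalIntegral.integral_congr (a := b) (g := fun _ => 0) fun x hx =>
      Real.sqrt_eq_zero_of_nonpos (sub_nonpos.2 (hc x (uIcc_of_le hbd ▸ hx))),
    intervalIntegral.integral_zero, add_zero]

namespace IsFlow

variable {T : EReal} {η u : ℝ → ℝ → ℝ} {x₀ : ℝ → ℝ} {S t t₁ ℓ : ℝ}

theorem exists_abs_dx_u_le (hflow : IsFlow T η u x₀) (ht₁ : t₁ ∈ times T) (ℓ : ℝ) :
    ∃ C, ∀ z ∈ Icc 0 ℓ, ∀ t ∈ Icc 0 t₁, |dx u (x₀ t + z) t / 2| ≤ C := by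
  obtain ⟨C, hC⟩ := (isCompact_Icc.prod isCompact_Icc).exists_bound_of_continuousOn
    ((hflow.continuousOn_frame (ℓ := ℓ) ht₁
      fun _ ht _ hx => hflow.continuousAt_dx_u ht hx).div_const 2)
  exact ⟨C, fun z hz t ht => hC (z, t) ⟨hz, ht⟩⟩

theorem abs_integral_smoothSqrt_sub_le (hflow : IsFlow T η u x₀) (hbreak : NoBreaking T η u x₀)
    (ht₁ : t₁ ∈ times T) (hℓ : 0 ≤ ℓ)
    (hright : ∀ t ∈ Icc 0 t₁, charQ S η u (x₀ t + ℓ) t ≤ 0)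
    (htop : ∀ z ∈ Icc 0 ℓ, charQ S η u (x₀ t₁ + z) t₁ ≤ 0) {C δ : ℝ}
    (hC : ∀ z ∈ Icc 0 ℓ, ∀ t ∈ Icc 0 t₁, |dx u (x₀ t + z) t / 2| ≤ C) (hδ : 0 < δ) :
    |(∫ t in (0 : ℝ)..t₁, (S - cgτ u (x₀ t) t) * smoothSqrt δ ((S - cgτ u (x₀ t) t) ^ 2))
      - ∫ z in (0 : ℝ)..ℓ, smoothSqrt δ (charQ S η u (x₀ 0 + z) 0)| ≤ C * t₁ * ℓ * δ := by
  rw [hflow.integral_shore_sub_integral_initial hbreak ht₁ hℓ hright htop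
    (hasDerivAt_smoothSqrt hδ) (continuous_deriv_smoothSqrt hδ) fun y => smoothSqrt_of_nonpos hδ]
  rw [← Real.norm_eq_abs]
  refine (intervalIntegral.norm_integral_le_of_norm_le_const (C := C * δ * |t₁ - 0|) fun z hz =>
    intervalIntegral.norm_integral_le_of_norm_le_const fun t ht => ?_).trans_eq ?_
  · have hbound := hC z (Ioc_subset_Icc_self (uIoc_of_le hℓ ▸ hz)) t
      (Ioc_subset_Icc_self (uIoc_of_le ht₁.1 ▸ ht))
    rw [norm_mul]
    exact mul_le_mul hbound (abs_smoothSqrt_sub_two_mul_deriv_le hδ _) (norm_nonneg _)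
      ((abs_nonneg _).trans hbound)
  · rw [sub_zero, sub_zero, abs_of_nonneg ht₁.1, abs_of_nonneg hℓ]
    ring

theorem integral_mul_abs_eq_integral_sqrt_charQ (hflow : IsFlow T η u x₀)
    (hbreak : NoBreaking T η u x₀) (ht₁ : t₁ ∈ times T) (hℓ : 0 ≤ ℓ)
    (hright : ∀ t ∈ Icc 0 t₁, charQ S η u (x₀ t + ℓ) t ≤ 0)
    (htop : ∀ z ∈ Icc 0 ℓ, charQ S η u (x₀ t₁ + z) t₁ ≤ 0) :
    ∫ t in (0 : ℝ)..t₁, (S - cgτ u (x₀ t) t) * |S - cgτ u (x₀ t) t|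
      = ∫ z in (0 : ℝ)..ℓ, √(charQ S η u (x₀ 0 + z) 0) := by
  obtain ⟨C, hC⟩ := hflow.exists_abs_dx_u_le ht₁ ℓ
  have hshore : ContinuousOn (fun t => S - cgτ u (x₀ t) t) (Icc 0 t₁) := fun t ht =>
    (hflow.hasDerivWithinAt_cgτ_along (Icc_subset_times ht₁ ht) le_rfl
      ((hflow.hasDerivWithinAt_shore hbreak (Icc_subset_times ht₁ ht)).mono fun _ hr => hr.1)
      (hasDerivWithinAt_id t _)).continuousWithinAt.const_sub S
  have hinitial : ContinuousOn (fun z => charQ S η u (x₀ 0 + z) 0) (Icc 0 ℓ) :=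
    (hflow.continuousOn_frame (t₁ := t₁) ht₁ fun _ ht _ hx =>
      (hflow.contDiffAt_charQ ht hx).continuousAt).comp (f := fun z => (z, (0 : ℝ)))
      (by fun_prop) fun z hz => ⟨hz, le_rfl, ht₁.1⟩
  obtain ⟨M, hM⟩ := isCompact_Icc.exists_bound_of_continuousOn hshore
  refine eq_of_forall_abs_sub_le_mul (K := M * t₁ + C * t₁ * ℓ + ℓ) fun δ hδ => ?_
  have hsmooth := hflow.abs_integral_smoothSqrt_sub_le hbreak ht₁ hℓ hright htop hC hδ
  have hleft := abs_integral_sub_integral_le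
    (f := fun t => (S - cgτ u (x₀ t) t) * |S - cgτ u (x₀ t) t|)
    (g := fun t => (S - cgτ u (x₀ t) t) * smoothSqrt δ ((S - cgτ u (x₀ t) t) ^ 2)) ht₁.1
    (hshore.mul hshore.abs)
    (hshore.mul ((continuous_smoothSqrt hδ).comp_continuousOn (hshore.pow 2))) fun t ht => by
      rw [← mul_sub, ← Real.sqrt_sq_eq_abs (S - cgτ u (x₀ t) t), abs_mul]
      exact mul_le_mul (hM t ht) (abs_sqrt_sub_smoothSqrt_le hδ _) (abs_nonneg _)
        ((norm_nonneg _).trans (hM t ht))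
  have hright := abs_integral_sub_integral_le
    (g := fun z => smoothSqrt δ (charQ S η u (x₀ 0 + z) 0)) hℓ hinitial.sqrt
    ((continuous_smoothSqrt hδ).comp_continuousOn hinitial) fun z _ =>
      abs_sqrt_sub_smoothSqrt_le hδ _
  rw [sub_zero] at hleft hright
  rw [abs_le] at *
  constructor <;> linarith

theorem continuousOn_depth (hflow : IsFlow T η u x₀) (ht : t ∈ times T) :
    ContinuousOn (fun x => depth η x t) (Ici (x₀ t)) :=
  fun _ hx => (hflow.hasDerivAt_depth ht hx).continuousAt.continuousWithinAt

theorem exists_charQ_nonpos (hflow : IsFlow T η u x₀) (hbreak : NoBreaking T η u x₀)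
    (ht₁ : t₁ ∈ times T) (c : ℝ) :
    ∃ ℓ, c ≤ ℓ ∧ (∀ t ∈ Icc 0 t₁, charQ (shoreτ x₀ t₁) η u (x₀ t + ℓ) t ≤ 0) ∧
      ∀ z, 0 ≤ z → charQ (shoreτ x₀ t₁) η u (x₀ t₁ + z) t₁ ≤ 0 := by
  obtain ⟨L, hL⟩ := hflow.exists_shoreτ_le_riemann hbreak ht₁
  obtain ⟨m, hm⟩ := (isCompact_Icc.image_of_continuousOn
    (hflow.shore_cont.mono (Icc_subset_times ht₁))).bddBelow
  refine ⟨max c (L - m), le_max_left _ _, fun t ht => ?_, fun z hz => ?_⟩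
  · have hLt : L ≤ x₀ t + max c (L - m) := by
      linarith [hm (mem_image_of_mem x₀ ht), le_max_right c (L - m)]
    exact sub_nonpos.2 <| hflow.sq_shoreτ_sub_cgτ_le_depth hbreak ht₁ ht
      ((hL t ht).1.trans hLt) ((hL t ht).2 _ hLt)
  · have hx : x₀ t₁ ≤ x₀ t₁ + z := le_add_of_nonneg_right hz
    have hriemann := (hflow.strictMonoOn_riemann hbreak ht₁ (one_pow 2)).monotoneOn
      (mem_Ici.2 le_rfl) hx hx
    refine sub_nonpos.2 <| hflow.sq_shoreτ_sub_cgτ_le_depth hbreak ht₁ ⟨ht₁.1, le_rfl⟩ hx ?_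
    simpa [riemann, hflow.cgσ_shore ht₁, ← hflow.shoreτ_eq hbreak ht₁] using hriemann

theorem integral_sqrt_sq_shoreτ_sub_depth (hflow : IsFlow T η u x₀)
    (hbreak : NoBreaking T η u x₀) (hu₀ : ∀ x, x₀ 0 ≤ x → u x 0 = 0) (ht₁ : t₁ ∈ times T)
    {b : ℝ} (hb : x₀ 0 ≤ b) (hSb : shoreτ x₀ t₁ ^ 2 ≤ depth η b 0) :
    ∫ x in (x₀ 0)..b, √(shoreτ x₀ t₁ ^ 2 - depth η x 0)
      = ∫ t in (0 : ℝ)..t₁, (shoreτ x₀ t₁ - shoreτ x₀ t) ^ 2 := by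
  have h0 := times_of_le ht₁ le_rfl ht₁.1
  obtain ⟨ℓ, hbℓ, hright, htop⟩ := hflow.exists_charQ_nonpos hbreak ht₁ (b - x₀ 0)
  have hℓ : 0 ≤ ℓ := (sub_nonneg.2 hb).trans hbℓ
  have hshore : ∫ t in (0 : ℝ)..t₁, (shoreτ x₀ t₁ - cgτ u (x₀ t) t)
      * |shoreτ x₀ t₁ - cgτ u (x₀ t) t| = ∫ t in (0 : ℝ)..t₁, (shoreτ x₀ t₁ - shoreτ x₀ t) ^ 2 :=
    intervalIntegral.integral_congr fun t ht => by
      rw [uIcc_of_le ht₁.1] at ht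
      have htT := Icc_subset_times ht₁ ht
      have hle := (hflow.strictMonoOn_shoreτ hbreak).monotoneOn htT ht₁ ht.2
      rw [← hflow.shoreτ_eq hbreak htT, abs_of_nonneg (sub_nonneg.2 hle), sq]
  have hinitial : ∫ z in (0 : ℝ)..ℓ, √(charQ (shoreτ x₀ t₁) η u (x₀ 0 + z) 0)
      = ∫ x in (x₀ 0)..(x₀ 0 + ℓ), √(shoreτ x₀ t₁ ^ 2 - depth η x 0) := by
    have hshift := intervalIntegral.integral_comp_add_left (a := 0) (b := ℓ)
      (fun x => √(shoreτ x₀ t₁ ^ 2 - depth η x 0)) (x₀ 0)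
    rw [add_zero] at hshift
    rw [← hshift]
    refine intervalIntegral.integral_congr fun z hz => ?_
    rw [uIcc_of_le hℓ] at hz
    simp [charQ, cgτ, hu₀ _ (le_add_of_nonneg_right hz.1)]
  rw [← hshore, hflow.integral_mul_abs_eq_integral_sqrt_charQ hbreak ht₁ hℓ hright
    fun z hz => htop z hz.1, hinitial]
  refine (integral_sqrt_const_sub_eq_of_le hb (by linarith)
    ((hflow.continuousOn_depth h0).mono Icc_subset_Ici_self) fun x hx => hSb.trans ?_).symm
  exact (hflow.strictMonoOn_depth hbreak h0).monotoneOn hb (hb.trans hx.1) hx.1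

theorem exists_shoreτ_eq (hflow : IsFlow T η u x₀) (hbreak : NoBreaking T η u x₀)
    (hu₀ : u (x₀ 0) 0 = 0) (ht₁ : t₁ ∈ times T) {R : ℝ} (hR : R ∈ Icc 0 (shoreτ x₀ t₁)) :
    ∃ r ∈ Icc 0 t₁, shoreτ x₀ r = R := by
  refine intermediate_value_Icc ht₁.1
    ((hflow.continuousOn_shoreτ hbreak).mono (Icc_subset_times ht₁)) ?_
  rwa [hflow.shoreτ_zero hbreak (times_of_le ht₁ le_rfl ht₁.1).2 hu₀]

theorem integral_sqrt_sq_sub_depth (hflow : IsFlow T η u x₀) (hbreak : NoBreaking T η u x₀)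
    (hu₀ : ∀ x, x₀ 0 ≤ x → u x 0 = 0) (ht₁ : t₁ ∈ times T) {R b : ℝ}
    (hR : R ∈ Icc 0 (shoreτ x₀ t₁)) (hb : x₀ 0 ≤ b) (hRb : R ^ 2 ≤ depth η b 0) :
    ∫ x in (x₀ 0)..b, √(R ^ 2 - depth η x 0)
      = ∫ t in (0 : ℝ)..t₁, max (R - shoreτ x₀ t) 0 ^ 2 := by
  obtain ⟨r, hr, rfl⟩ := hflow.exists_shoreτ_eq hbreak (hu₀ _ le_rfl) ht₁ hR
  have hrT := Icc_subset_times ht₁ hr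
  have hmono := (hflow.strictMonoOn_shoreτ hbreak).monotoneOn
  have hcont : ContinuousOn (fun t => max (shoreτ x₀ r - shoreτ x₀ t) 0 ^ 2) (Icc 0 t₁) :=
    (ContinuousOn.sup (continuousOn_const.sub
      ((hflow.continuousOn_shoreτ hbreak).mono (Icc_subset_times ht₁))) continuousOn_const).pow 2
  rw [hflow.integral_sqrt_sq_shoreτ_sub_depth hbreak hu₀ hrT hb hRb,
    ← intervalIntegral.integral_add_adjacent_intervals
      ((hcont.mono (Icc_subset_Icc_right hr.2)).intervalIntegrable_of_Icc hr.1)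
      ((hcont.mono (Icc_subset_Icc_left hr.1)).intervalIntegrable_of_Icc hr.2),
    intervalIntegral.integral_congr (a := r) (g := fun _ => 0), intervalIntegral.integral_zero,
    add_zero]
  · refine intervalIntegral.integral_congr fun t ht => ?_
    rw [uIcc_of_le hr.1] at ht
    simp only [max_eq_left (sub_nonneg.2 (hmono (Icc_subset_times hrT ht) hrT ht.2))]
  · intro t ht
    rw [uIcc_of_le hr.2] at ht
    have htT := Icc_subset_times ht₁ ⟨hr.1.trans ht.1, ht.2⟩
    simp [max_eq_right (sub_nonpos.2 (hmono hrT htT ht.1))]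

end IsFlow

end ShorelineIdentity

section BetaIntegral

variable {S ρ c : ℝ}

theorem hasDerivAt_mul_sqrt (y : ℝ) : HasDerivAt (fun y => y * √y) (3 / 2 * √y) y := by
  have hne (z : ℝ) (hz : z ≠ 0) : HasDerivAt (fun y => y * √y) (3 / 2 * √z) z := by
    refine ((hasDerivAt_id z).mul (Real.hasDerivAt_sqrt hz)).congr_deriv ?_
    rw [id, ← div_eq_mul_one_div, mul_comm 2, ← div_div, Real.div_sqrt]
    ring
  rcases eq_or_ne y 0 with rfl | hy
  · exact hasDerivAt_of_hasDerivAt_of_ne hne (by fun_prop) (by fun_prop)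
  · exact hne y hy

theorem hasDerivAt_arcsin_div (hρ : ρ ∈ Ioo (-S) S) :
    HasDerivAt (fun ρ => Real.arcsin (ρ / S)) (√(S ^ 2 - ρ ^ 2))⁻¹ ρ := by
  have hS : 0 < S := by linarith [hρ.1, hρ.2]
  have hlt : ρ / S < 1 := (div_lt_one hS).2 hρ.2
  have hgt : -1 < ρ / S := (lt_div_iff₀ hS).2 (by linarith [hρ.1])
  refine ((Real.hasDerivAt_arcsin hgt.ne' hlt.ne).comp ρ
    ((hasDerivAt_id ρ).div_const S)).congr_deriv ?_
  rw [show S ^ 2 - ρ ^ 2 = S ^ 2 * (1 - (ρ / S) ^ 2) by field_simp, Real.sqrt_mul (sq_nonneg S),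
    Real.sqrt_sq hS.le, mul_inv, one_div, one_div, mul_comm]

theorem continuous_arcsin_div (S : ℝ) : Continuous fun ρ => Real.arcsin (ρ / S) :=
  Real.continuous_arcsin.comp (continuous_id.div_const S)

theorem hasDerivAt_arcsin_sub_mul_sqrt (hρ : ρ ∈ Ioo (-S) S) :
    HasDerivAt (fun ρ => S ^ 2 * Real.arcsin (ρ / S) - ρ * √(S ^ 2 - ρ ^ 2))
      (2 * ρ ^ 2 / √(S ^ 2 - ρ ^ 2)) ρ := by
  have hpos : 0 < S ^ 2 - ρ ^ 2 := by nlinarith [hρ.1, hρ.2]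
  have := Real.sqrt_pos.2 hpos
  refine (((hasDerivAt_arcsin_div hρ).const_mul (S ^ 2)).sub ((hasDerivAt_id ρ).mul
    (((hasDerivAt_pow 2 ρ).const_sub (S ^ 2)).sqrt hpos.ne'))).congr_deriv ?_
  simp only [id]
  field_simp
  rw [Real.sq_sqrt hpos.le]
  ring

theorem intervalIntegrable_inv_sqrt_sq_sub_sq (hS : 0 < S) :
    IntervalIntegrable (fun ρ => (√(S ^ 2 - ρ ^ 2))⁻¹) volume 0 S :=
  (intervalIntegrable_iff_integrableOn_Ioc_of_le hS.le).2 <|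
    intervalIntegral.integrableOn_deriv_of_nonneg (continuous_arcsin_div S).continuousOn
      (fun _ hρ => hasDerivAt_arcsin_div ⟨by linarith [hρ.1], hρ.2⟩) fun _ _ => by positivity

theorem intervalIntegrable_div_sqrt_sq_sub_sq {f : ℝ → ℝ} (hS : 0 < S)
    (hf : ContinuousOn f (Icc 0 S)) :
    IntervalIntegrable (fun ρ => f ρ / √(S ^ 2 - ρ ^ 2)) volume 0 S := by
  simp only [div_eq_mul_inv]
  exact (intervalIntegrable_inv_sqrt_sq_sub_sq hS).continuousOn_mul (by rwa [uIcc_of_le hS.le])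

theorem abel_congr {f g : ℝ → ℝ} (hS : 0 ≤ S) (h : EqOn f g (Icc 0 S)) : abel f S = abel g S :=
  intervalIntegral.integral_congr fun ρ hρ => by
    simp only [h (uIcc_of_le hS ▸ hρ)]

theorem abel_add {f g : ℝ → ℝ} (hS : 0 < S) (hf : ContinuousOn f (Icc 0 S))
    (hg : ContinuousOn g (Icc 0 S)) : abel (fun ρ => f ρ + g ρ) S = abel f S + abel g S := by
  simp only [abel, add_div]
  exact intervalIntegral.integral_add (intervalIntegrable_div_sqrt_sq_sub_sq hS hf)
    (intervalIntegrable_div_sqrt_sq_sub_sq hS hg)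

theorem abel_const_mul (c : ℝ) (f : ℝ → ℝ) (S : ℝ) :
    abel (fun ρ => c * f ρ) S = c * abel f S := by
  simp only [abel, mul_div_assoc]
  exact intervalIntegral.integral_const_mul _ _

theorem abel_one (hS : 0 < S) : abel (fun _ => 1) S = Real.pi / 2 := by
  rw [abel, intervalIntegral.integral_eq_sub_of_hasDerivAt_of_le hS.le
    (continuous_arcsin_div S).continuousOn (fun ρ hρ => (hasDerivAt_arcsin_div
      ⟨by linarith [hρ.1], hρ.2⟩).congr_deriv (one_div _).symm)
    (intervalIntegrable_div_sqrt_sq_sub_sq hS continuousOn_const)]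
  simp [hS.ne']

theorem hasDerivAt_arcsin_sqrt_sq_sub (hcS : c < S ^ 2) (hρ : ρ ∈ Ioo 0 S) (hρc : ρ ^ 2 ≠ c) :
    HasDerivAt (fun ρ => ((S ^ 2 - c) * Real.arcsin (√(ρ ^ 2 - c) / √(S ^ 2 - c))
      - √(ρ ^ 2 - c) * √(S ^ 2 - c - √(ρ ^ 2 - c) ^ 2)) / 2)
      (ρ * √(ρ ^ 2 - c) / √(S ^ 2 - ρ ^ 2)) ρ := by
  rcases hρc.lt_or_gt with hlt | hgt
  · rw [Real.sqrt_eq_zero_of_nonpos (sub_nonpos.2 hlt.le), mul_zero, zero_div]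
    refine (hasDerivAt_const ρ 0).congr_of_eventuallyEq ?_
    filter_upwards [(continuous_pow 2).continuousAt.eventually_lt continuousAt_const hlt] with r hr
    simp [Real.sqrt_eq_zero_of_nonpos (sub_nonpos.2 hr.le)]
  · have hB : √(S ^ 2 - c) ^ 2 = S ^ 2 - c := Real.sq_sqrt (sub_nonneg.2 hcS.le)
    have hv : √(ρ ^ 2 - c) ^ 2 = ρ ^ 2 - c := Real.sq_sqrt (sub_nonneg.2 hgt.le)
    have hvB : √(ρ ^ 2 - c) ∈ Ioo (-√(S ^ 2 - c)) √(S ^ 2 - c) :=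
      ⟨(neg_neg_of_pos (Real.sqrt_pos.2 (sub_pos.2 hcS))).trans_le (Real.sqrt_nonneg _),
        Real.sqrt_lt_sqrt (sub_nonneg.2 hgt.le) (by nlinarith [hρ.1, hρ.2])⟩
    have := Real.sqrt_pos.2 (sub_pos.2 hgt)
    have hcomp := ((hasDerivAt_arcsin_sub_mul_sqrt hvB).comp ρ
      (((hasDerivAt_pow 2 ρ).sub_const c).sqrt (sub_pos.2 hgt).ne')).div_const 2
    simp only [hB] at hcomp
    refine hcomp.congr_deriv ?_
    rw [show S ^ 2 - c - √(ρ ^ 2 - c) ^ 2 = S ^ 2 - ρ ^ 2 by rw [hv]; ring]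
    field_simp
    simp

theorem abel_mul_sqrt_sq_sub (hc : 0 ≤ c) (hS : 0 < S) (hcS : c ≤ S ^ 2) :
    abel (fun ρ => ρ * √(ρ ^ 2 - c)) S = Real.pi / 4 * (S ^ 2 - c) := by
  rcases hcS.eq_or_lt with rfl | hlt
  · rw [abel_congr hS.le (g := fun _ => 0 * 1), abel_const_mul]
    · ring
    · intro ρ hρ
      have hle : ρ ^ 2 ≤ S ^ 2 := pow_le_pow_left₀ hρ.1 hρ.2 2
      simp [Real.sqrt_eq_zero_of_nonpos (sub_nonpos.2 hle)]
  · have hcont : Continuous fun v =>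
        (S ^ 2 - c) * Real.arcsin (v / √(S ^ 2 - c)) - v * √(S ^ 2 - c - v ^ 2) :=
      ((continuous_arcsin_div _).const_mul _).sub (by fun_prop)
    rw [abel, MeasureTheory.integral_eq_of_hasDerivAt_off_countable_of_le _ _ hS.le
      (countable_singleton √c)
      ((hcont.comp (f := fun ρ => √(ρ ^ 2 - c)) (by fun_prop)).div_const 2).continuousOn
      (fun ρ hρ => hasDerivAt_arcsin_sqrt_sq_sub hlt hρ.1 fun h => hρ.2 ?_)
      (intervalIntegrable_div_sqrt_sq_sub_sq hS (by fun_prop))]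
    · have hB := Real.sqrt_pos.2 (sub_pos.2 hlt)
      have hzero : √(0 ^ 2 - c) = 0 := Real.sqrt_eq_zero_of_nonpos (by linarith)
      simp only [Function.comp, hzero, div_self hB.ne', Real.sq_sqrt (sub_pos.2 hlt).le, zero_div,
        Real.arcsin_one, Real.arcsin_zero, sub_self, Real.sqrt_zero]
      ring
    · rw [mem_singleton_iff, ← h, Real.sqrt_sq hρ.1.1.le]

theorem abel_sq (hS : 0 < S) : abel (fun ρ => ρ ^ 2) S = Real.pi / 4 * S ^ 2 := by
  rw [abel_congr hS.le (g := fun ρ => ρ * √(ρ ^ 2 - 0)),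
    abel_mul_sqrt_sq_sub le_rfl hS (sq_nonneg S), sub_zero]
  exact fun ρ hρ => by simp only [sub_zero, Real.sqrt_sq hρ.1, ← sq]

end BetaIntegral

section Profile

variable {a b R S : ℝ}

theorem continuousOn_integral_of_continuousOn {s : Set ℝ} {g : ℝ → ℝ → ℝ} (hab : a ≤ b)
    (hs : IsCompact s) (hg : ContinuousOn (Function.uncurry g) (s ×ˢ Icc a b)) :
    ContinuousOn (fun r => ∫ x in a..b, g r x) s := by
  obtain ⟨C, hC⟩ := (hs.prod isCompact_Icc).exists_bound_of_continuousOn hg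
  have hmaps (r : ℝ) (hr : r ∈ s) : ContinuousOn (g r) (Icc a b) :=
    hg.comp (f := fun x => (r, x)) (by fun_prop) fun x hx => ⟨hr, hx⟩
  have hsub : uIoc a b ⊆ Icc a b := uIoc_of_le hab ▸ Ioc_subset_Icc_self
  exact fun r hr => intervalIntegral.continuousWithinAt_of_dominated_interval
    (eventually_mem_nhdsWithin.mono fun r hr =>
      ((hmaps r hr).mono hsub).aestronglyMeasurable measurableSet_uIoc)
    (bound := fun _ => C)
    (eventually_mem_nhdsWithin.mono fun r hr => ae_of_all _ fun x hx => hC (r, x) ⟨hr, hsub hx⟩)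
    intervalIntegrable_const
    (ae_of_all _ fun x hx => (hg.comp (f := fun r => (r, x)) (by fun_prop)
      fun r hr => ⟨hr, hsub hx⟩) r hr)

theorem abel_integral {g : ℝ → ℝ → ℝ} (hab : a ≤ b) (hS : 0 < S)
    (hg : ContinuousOn (Function.uncurry g) (Icc 0 S ×ˢ Icc a b)) :
    abel (fun ρ => ∫ x in a..b, g ρ x) S = ∫ x in a..b, abel (fun ρ => g ρ x) S := by
  have hweight : IntegrableOn (fun ρ => (√(S ^ 2 - ρ ^ 2))⁻¹) (Icc 0 S) :=
    (intervalIntegrable_iff_integrableOn_Icc_of_le hS.le).1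
      (intervalIntegrable_inv_sqrt_sq_sub_sq hS)
  have hprod : IntegrableOn (fun p : ℝ × ℝ => (√(S ^ 2 - p.1 ^ 2))⁻¹) (Icc 0 S ×ˢ Icc a b) := by
    have := hweight.comp_fst (volume.restrict (Icc a b))
    rwa [Measure.prod_restrict] at this
  have hintegrable : Integrable (Function.uncurry fun ρ x => g ρ x / √(S ^ 2 - ρ ^ 2))
      ((volume.restrict (Icc 0 S)).prod (volume.restrict (Icc a b))) := by
    rw [Measure.prod_restrict]
    exact hprod.continuousOn_mul hg (isCompact_Icc.prod isCompact_Icc)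
  simp only [abel, intervalIntegral.integral_of_le, hab, hS.le, ← integral_Icc_eq_integral_Ioc]
  rw [← integral_integral_swap hintegrable]
  simp only [integral_div]

theorem hasDerivAt_integral_of_continuousOn {F F' : ℝ → ℝ → ℝ} (hab : a ≤ b)
    (hF : ∀ r, ContinuousOn (F r) (Icc a b))
    (hF' : ContinuousOn (Function.uncurry F') (univ ×ˢ Icc a b))
    (hderiv : ∀ r, ∀ x ∈ Icc a b, HasDerivAt (fun r => F r x) (F' r x) r) (R : ℝ) :
    HasDerivAt (fun r => ∫ x in a..b, F r x) (∫ x in a..b, F' R x) R := by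
  obtain ⟨C, hC⟩ := ((isCompact_closedBall R 1).prod isCompact_Icc).exists_bound_of_continuousOn
    (hF'.mono (prod_mono_left (subset_univ _)))
  have hsub : uIoc a b ⊆ Icc a b := uIoc_of_le hab ▸ Ioc_subset_Icc_self
  refine (intervalIntegral.hasDerivAt_integral_of_dominated_loc_of_deriv_le
    (Metric.closedBall_mem_nhds R one_pos) (bound := fun _ => C) (Eventually.of_forall fun r =>
      ((hF r).mono hsub).aestronglyMeasurable measurableSet_uIoc)
    ((hF R).intervalIntegrable_of_Icc hab) ?_
    (ae_of_all _ fun x hx r hr => hC (r, x) ⟨hr, hsub hx⟩) intervalIntegrable_const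
    (ae_of_all _ fun x hx r _ => hderiv r x (hsub hx))).2
  exact (hF'.comp (f := fun x => (R, x)) (by fun_prop)
    fun x hx => ⟨mem_univ _, hsub hx⟩).aestronglyMeasurable measurableSet_uIoc

theorem hasDerivAt_sq_sub_mul_sqrt (c R : ℝ) :
    HasDerivAt (fun r => (r ^ 2 - c) * √(r ^ 2 - c)) (3 * (R * √(R ^ 2 - c))) R := by
  refine ((hasDerivAt_mul_sqrt (R ^ 2 - c)).comp R
    ((hasDerivAt_pow 2 R).sub_const c)).congr_deriv ?_
  ring

theorem monotoneOn_mul_sqrt_sq_sub (c : ℝ) :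
    MonotoneOn (fun r => r * √(r ^ 2 - c)) (Ici 0) := fun _ hr _ hs hrs =>
  mul_le_mul hrs (Real.sqrt_le_sqrt (sub_le_sub_right (pow_le_pow_left₀ hr hrs 2) c))
    (Real.sqrt_nonneg _) hs

/-- A `C²` increasing profile `h` on `[a, b]` with `h a = 0`, described through the reciprocal
slope `k = 1 / h'` and its derivative `k'`, which are what integration by parts brings in. -/
structure IsProfile (a b : ℝ) (h k k' : ℝ → ℝ) : Prop where
  le : a ≤ b
  apply_left : h a = 0
  pos : ∀ x ∈ Icc a b, 0 < k x
  hasDerivAt : ∀ x ∈ Icc a b, HasDerivAt h (k x)⁻¹ x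
  hasDerivAt_recip : ∀ x ∈ Icc a b, HasDerivAt k (k' x) x
  continuousOn_deriv : ContinuousOn k' (Icc a b)

/-- Half the derivative in `R` of `∫ √(R² - h)`, in the form produced by integration by parts. -/
noncomputable def profileRate (a b : ℝ) (h k k' : ℝ → ℝ) (R : ℝ) : ℝ :=
  R ^ 2 * k a + ∫ x in a..b, R * √(R ^ 2 - h x) * k' x

namespace IsProfile

variable {h k k' : ℝ → ℝ}

theorem continuousOn (hprof : IsProfile a b h k k') : ContinuousOn h (Icc a b) :=
  fun x hx => (hprof.hasDerivAt x hx).continuousAt.continuousWithinAt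

theorem continuousOn_recip (hprof : IsProfile a b h k k') : ContinuousOn k (Icc a b) :=
  fun x hx => (hprof.hasDerivAt_recip x hx).continuousAt.continuousWithinAt

theorem strictMonoOn (hprof : IsProfile a b h k k') : StrictMonoOn h (Icc a b) :=
  strictMonoOn_of_deriv_pos (convex_Icc a b) hprof.continuousOn fun x hx => by
    rw [interior_Icc] at hx
    rw [(hprof.hasDerivAt x (Ioo_subset_Icc_self hx)).deriv]
    exact inv_pos.2 (hprof.pos x (Ioo_subset_Icc_self hx))

theorem integral_by_parts (hprof : IsProfile a b h k k') {Φ φ : ℝ → ℝ}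
    (hΦ : ∀ y, HasDerivAt Φ (φ y) y) (hφ : Continuous φ) {c : ℝ} (hc : Φ (c - h b) = 0) :
    ∫ x in a..b, φ (c - h x) = Φ c * k a + ∫ x in a..b, Φ (c - h x) * k' x := by
  have hΦc : Continuous Φ := continuous_iff_continuousAt.2 fun y => (hΦ y).continuousAt
  have hsub : ContinuousOn (fun x => c - h x) (Icc a b) := continuousOn_const.sub hprof.continuousOn
  have hderiv : ∀ x ∈ uIcc a b, HasDerivAt (fun x => Φ (c - h x) * k x)
      (-φ (c - h x) + Φ (c - h x) * k' x) x := fun x hx => by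
    rw [uIcc_of_le hprof.le] at hx
    refine (((hΦ (c - h x)).comp x ((hprof.hasDerivAt x hx).const_sub c)).mul
      (hprof.hasDerivAt_recip x hx)).congr_deriv ?_
    have hpos := hprof.pos x hx
    simp only [Function.comp]
    field_simp
  have hintφ : IntervalIntegrable (fun x => φ (c - h x)) volume a b :=
    (hφ.comp_continuousOn hsub).intervalIntegrable_of_Icc hprof.le
  have hintΦ : IntervalIntegrable (fun x => Φ (c - h x) * k' x) volume a b :=
    ((hΦc.comp_continuousOn hsub).mul hprof.continuousOn_deriv).intervalIntegrable_of_Icc hprof.le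
  have hftc := intervalIntegral.integral_eq_sub_of_hasDerivAt hderiv (hintφ.neg.add hintΦ)
  rw [intervalIntegral.integral_add (f := fun x => -φ (c - h x)) hintφ.neg hintΦ,
    intervalIntegral.integral_neg, hc, zero_mul, hprof.apply_left, sub_zero] at hftc
  linear_combination -hftc

theorem integral_sqrt_sq_sub (hprof : IsProfile a b h k k') (hR : 0 ≤ R) (hRb : R ^ 2 ≤ h b) :
    ∫ x in a..b, √(R ^ 2 - h x)
      = 2 / 3 * (R ^ 3 * k a + ∫ x in a..b, (R ^ 2 - h x) * √(R ^ 2 - h x) * k' x) := by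
  have hparts := hprof.integral_by_parts (c := R ^ 2) hasDerivAt_mul_sqrt (by fun_prop)
    (by rw [Real.sqrt_eq_zero_of_nonpos (sub_nonpos.2 hRb), mul_zero])
  rw [intervalIntegral.integral_const_mul, Real.sqrt_sq hR] at hparts
  linear_combination 2 / 3 * hparts

theorem length_eq (hprof : IsProfile a b h k k') :
    b - a = h b * k a + ∫ x in a..b, (h b - h x) * k' x := by
  simpa using hprof.integral_by_parts (c := h b) (fun y => hasDerivAt_id y) continuous_const
    (sub_self _)

theorem continuousOn_rate_integrand (hprof : IsProfile a b h k k') :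
    ContinuousOn (Function.uncurry fun r x => r * √(r ^ 2 - h x) * k' x) (univ ×ˢ Icc a b) :=
  (continuousOn_fst.mul ((continuousOn_fst.pow 2).sub
    (hprof.continuousOn.comp continuousOn_snd fun _ hp => hp.2)).sqrt).mul
    (hprof.continuousOn_deriv.comp continuousOn_snd fun _ hp => hp.2)

theorem hasDerivAt_integral_sqrt (hprof : IsProfile a b h k k') (R : ℝ) :
    HasDerivAt (fun r => 2 / 3 * (r ^ 3 * k a
      + ∫ x in a..b, (r ^ 2 - h x) * √(r ^ 2 - h x) * k' x)) (2 * profileRate a b h k k' R) R := by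
  have hsub (r : ℝ) : ContinuousOn (fun x => r ^ 2 - h x) (Icc a b) :=
    continuousOn_const.sub hprof.continuousOn
  have hcont : ContinuousOn (Function.uncurry fun r x => 3 * (r * √(r ^ 2 - h x) * k' x))
      (univ ×ˢ Icc a b) := continuousOn_const.mul hprof.continuousOn_rate_integrand
  have hderiv_int := hasDerivAt_integral_of_continuousOn
    (F := fun r x => (r ^ 2 - h x) * √(r ^ 2 - h x) * k' x) hprof.le
    (fun r => ((hsub r).mul (hsub r).sqrt).mul hprof.continuousOn_deriv) hcont
    (fun r x _ => ((hasDerivAt_sq_sub_mul_sqrt (h x) r).mul_const (k' x)).congr_deriv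
      (mul_assoc _ _ _)) R
  refine ((((hasDerivAt_pow 3 R).mul_const (k a)).add hderiv_int).const_mul (2 / 3)).congr_deriv ?_
  rw [profileRate, intervalIntegral.integral_const_mul]
  push_cast
  ring

theorem profileRate_eq (hprof : IsProfile a b h k k') {θ : ℝ → ℝ} {t₁ : ℝ} (ht₁ : 0 ≤ t₁)
    (hS : 0 < S) (hSb : S ^ 2 ≤ h b) (hθ : ContinuousOn θ (Icc 0 t₁))
    (hid : ∀ R ∈ Icc 0 S,
      ∫ x in a..b, √(R ^ 2 - h x) = ∫ t in (0 : ℝ)..t₁, max (R - θ t) 0 ^ 2)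
    (hR : R ∈ Icc 0 S) :
    profileRate a b h k k' R = ∫ t in (0 : ℝ)..t₁, max (R - θ t) 0 := by
  have hcont : ContinuousOn (Function.uncurry fun r t => 2 * max (r - θ t) 0)
      (univ ×ˢ Icc 0 t₁) :=
    continuousOn_const.mul (ContinuousOn.sup (continuousOn_fst.sub
      (hθ.comp continuousOn_snd fun _ hp => hp.2)) continuousOn_const)
  have hright := hasDerivAt_integral_of_continuousOn (F := fun r t => max (r - θ t) 0 ^ 2) ht₁
    (fun r => (ContinuousOn.sup (continuousOn_const.sub hθ) continuousOn_const).pow 2) hcont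
    (fun r t _ => ((hasDerivAt_max_zero_sq (r - θ t)).comp r
      ((hasDerivAt_id r).sub_const (θ t))).congr_deriv (mul_one _)) R
  have heq : EqOn (fun r => 2 / 3 * (r ^ 3 * k a
      + ∫ x in a..b, (r ^ 2 - h x) * √(r ^ 2 - h x) * k' x))
      (fun r => ∫ t in (0 : ℝ)..t₁, max (r - θ t) 0 ^ 2) (Icc 0 S) := fun r hr =>
    (hprof.integral_sqrt_sq_sub hr.1 ((pow_le_pow_left₀ hr.1 hr.2 2).trans hSb)).symm.trans
      (hid r hr)
  have huniq := (uniqueDiffOn_Icc hS R hR).eq_deriv _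
    (hprof.hasDerivAt_integral_sqrt R).hasDerivWithinAt
    (hright.hasDerivWithinAt.congr heq (heq hR))
  rw [intervalIntegral.integral_const_mul] at huniq
  exact mul_left_cancel₀ two_ne_zero huniq

theorem continuousOn_profileRate (hprof : IsProfile a b h k k') (S : ℝ) :
    ContinuousOn (profileRate a b h k k') (Icc 0 S) :=
  ContinuousOn.add (by fun_prop) (continuousOn_integral_of_continuousOn hprof.le isCompact_Icc
    (hprof.continuousOn_rate_integrand.mono (prod_mono_left (subset_univ _))))

theorem mem_Icc_of_mem (hprof : IsProfile a b h k k') {x : ℝ} (hx : x ∈ Icc a b) :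
    h x ∈ Icc 0 (h b) :=
  ⟨hprof.apply_left ▸ hprof.strictMonoOn.monotoneOn (left_mem_Icc.2 hprof.le) hx hx.1,
    hprof.strictMonoOn.monotoneOn hx (right_mem_Icc.2 hprof.le) hx.2⟩

theorem abel_profileRate (hprof : IsProfile a b h k k') (hS : 0 < S) (hb : h b = S ^ 2) :
    abel (profileRate a b h k k') S = Real.pi / 4 * (b - a) := by
  have hcont : ContinuousOn (Function.uncurry fun r x => r * √(r ^ 2 - h x) * k' x)
      (Icc 0 S ×ˢ Icc a b) :=
    hprof.continuousOn_rate_integrand.mono (prod_mono_left (subset_univ _))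
  have hleft : abel (fun ρ => ρ ^ 2 * k a) S = k a * (Real.pi / 4 * S ^ 2) := by
    simp only [mul_comm _ (k a)]
    rw [abel_const_mul, abel_sq hS]
  have hfiber : ∀ x ∈ Icc a b, abel (fun ρ => ρ * √(ρ ^ 2 - h x) * k' x) S
      = Real.pi / 4 * ((h b - h x) * k' x) := fun x hx => by
    obtain ⟨hx0, hxb⟩ := hprof.mem_Icc_of_mem hx
    simp only [mul_comm _ (k' x)]
    rw [abel_const_mul, abel_mul_sqrt_sq_sub hx0 hS (hb ▸ hxb), hb]
    ring
  have hsplit : abel (profileRate a b h k k') S = abel (fun ρ => ρ ^ 2 * k a) S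
      + abel (fun ρ => ∫ x in a..b, ρ * √(ρ ^ 2 - h x) * k' x) S :=
    abel_add hS (by fun_prop) (continuousOn_integral_of_continuousOn hprof.le isCompact_Icc hcont)
  rw [hsplit, hleft, abel_integral hprof.le hS hcont, intervalIntegral.integral_congr
    (g := fun x => Real.pi / 4 * ((h b - h x) * k' x))
    fun x hx => hfiber x (uIcc_of_le hprof.le ▸ hx), intervalIntegral.integral_const_mul,
    hprof.length_eq, hb]
  ring

theorem integral_mul_sqrt_inv (hprof : IsProfile a b h k k') (hR : 0 ≤ R) (hRb : R ^ 2 ≤ h b) :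
    ∫ x in a..b, R * √(R ^ 2 - h x) * (k x)⁻¹ = 2 / 3 * R ^ 4 := by
  have hderiv : ∀ x ∈ uIcc a b, HasDerivAt
      (fun x => -(2 / 3) * (R * ((R ^ 2 - h x) * √(R ^ 2 - h x))))
      (R * √(R ^ 2 - h x) * (k x)⁻¹) x := fun x hx => by
    rw [uIcc_of_le hprof.le] at hx
    refine ((((hasDerivAt_mul_sqrt (R ^ 2 - h x)).comp x
      ((hprof.hasDerivAt x hx).const_sub (R ^ 2))).const_mul R).const_mul (-(2 / 3))).congr_deriv ?_
    ring
  have hsub : ContinuousOn (fun x => R ^ 2 - h x) (Icc a b) :=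
    continuousOn_const.sub hprof.continuousOn
  rw [intervalIntegral.integral_eq_sub_of_hasDerivAt hderiv
    (((continuousOn_const.mul hsub.sqrt).mul (hprof.continuousOn_recip.inv₀
      fun x hx => (hprof.pos x hx).ne')).intervalIntegrable_of_Icc hprof.le),
    Real.sqrt_eq_zero_of_nonpos (sub_nonpos.2 hRb), hprof.apply_left, sub_zero, Real.sqrt_sq hR]
  ring

theorem exists_integral_rate_sub_le (hprof : IsProfile a b h k k') :
    ∃ M, 0 ≤ M ∧ ∀ R R' : ℝ, 0 ≤ R → R ≤ R' → R' ^ 2 ≤ h b →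
      (∫ x in a..b, R' * √(R' ^ 2 - h x) * k' x) - ∫ x in a..b, R * √(R ^ 2 - h x) * k' x
        ≤ M * (R' ^ 4 - R ^ 4) := by
  have hab := hprof.le
  obtain ⟨M, hM⟩ := isCompact_Icc.exists_bound_of_continuousOn
    (hprof.continuousOn_deriv.mul hprof.continuousOn_recip)
  have hM0 : 0 ≤ M := (norm_nonneg _).trans (hM a (left_mem_Icc.2 hab))
  have hk' : ∀ x ∈ Icc a b, k' x ≤ M * (k x)⁻¹ := fun x hx =>
    (le_mul_inv_iff₀ (hprof.pos x hx)).2 ((le_abs_self _).trans (hM x hx))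
  have hroot (r : ℝ) : ContinuousOn (fun x => r * √(r ^ 2 - h x)) (Icc a b) :=
    continuousOn_const.mul (continuousOn_const.sub hprof.continuousOn).sqrt
  have hintk' (r : ℝ) : IntervalIntegrable (fun x => r * √(r ^ 2 - h x) * k' x) volume a b :=
    ((hroot r).mul hprof.continuousOn_deriv).intervalIntegrable_of_Icc hab
  have hintk (r : ℝ) : IntervalIntegrable (fun x => r * √(r ^ 2 - h x) * (k x)⁻¹) volume a b :=
    ((hroot r).mul (hprof.continuousOn_recip.inv₀
      fun x hx => (hprof.pos x hx).ne')).intervalIntegrable_of_Icc hab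
  refine ⟨M * (2 / 3), by positivity, fun R R' hR hRR' hR' => ?_⟩
  rw [mul_assoc, mul_sub, ← hprof.integral_mul_sqrt_inv (hR.trans hRR') hR',
    ← hprof.integral_mul_sqrt_inv hR ((pow_le_pow_left₀ hR hRR' 2).trans hR'),
    ← intervalIntegral.integral_sub (hintk' _) (hintk' _),
    ← intervalIntegral.integral_sub (hintk _) (hintk _), ← intervalIntegral.integral_const_mul]
  refine intervalIntegral.integral_mono_on hab ((hintk' _).sub (hintk' _))
    (((hintk _).sub (hintk _)).const_mul M) fun x hx => ?_
  have hmono := monotoneOn_mul_sqrt_sq_sub (h x) hR (hR.trans hRR') hRR'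
  linear_combination mul_le_mul_of_nonneg_left (hk' x hx) (sub_nonneg.2 hmono)

theorem exists_profileRate_sub_le (hprof : IsProfile a b h k k') :
    ∃ C, 0 ≤ C ∧ ∀ R R' : ℝ, 0 ≤ R → R ≤ R' → R' ^ 2 ≤ h b →
      profileRate a b h k k' R' - profileRate a b h k k' R ≤ C * (R' - R) := by
  have hka := hprof.pos a (left_mem_Icc.2 hprof.le)
  obtain ⟨M, hM0, hM⟩ := hprof.exists_integral_rate_sub_le
  refine ⟨2 * √(h b) * k a + M * (4 * √(h b) ^ 3), by positivity, fun R R' hR hRR' hR' => ?_⟩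
  have hB : R' ≤ √(h b) := Real.le_sqrt_of_sq_le hR'
  have hsq : R' ^ 2 - R ^ 2 ≤ 2 * √(h b) * (R' - R) := by nlinarith
  have hquart : R' ^ 4 - R ^ 4 ≤ 4 * √(h b) ^ 3 * (R' - R) := by
    have hsum : R' ^ 2 + R ^ 2 ≤ 2 * √(h b) ^ 2 := by nlinarith
    nlinarith [mul_le_mul hsq hsum (by positivity) (by nlinarith)]
  simp only [profileRate]
  linear_combination hM R R' hR hRR' hR' + k a * hsq + M * hquart

end IsProfile

end Profile

section InitialProfile

theorem mul_sub_le_integral_sub_integral {θ : ℝ → ℝ} {r t : ℝ} (hr : 0 ≤ r) (hrt : r ≤ t)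
    (hcont : ContinuousOn θ (Icc 0 t)) (hmono : MonotoneOn θ (Icc 0 t)) :
    r * (θ t - θ r) ≤ (∫ s in (0 : ℝ)..t, θ t - θ s) - ∫ s in (0 : ℝ)..r, θ r - θ s := by
  have hintegrable (c : ℝ) {p q : ℝ} (hp : 0 ≤ p) (hpq : p ≤ q) (hq : q ≤ t) :
      IntervalIntegrable (fun s => c - θ s) volume p q :=
    ((continuousOn_const.sub hcont).mono (Icc_subset_Icc hp hq)).intervalIntegrable_of_Icc hpq
  have htail : 0 ≤ ∫ s in r..t, θ t - θ s := intervalIntegral.integral_nonneg hrt fun s hs =>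
    sub_nonneg.2 (hmono ⟨hr.trans hs.1, hs.2⟩ ⟨hr.trans hrt, le_rfl⟩ hs.2)
  have hhead : (∫ s in (0 : ℝ)..r, θ t - θ s) - ∫ s in (0 : ℝ)..r, θ r - θ s
      = r * (θ t - θ r) := by
    rw [← intervalIntegral.integral_sub (hintegrable _ le_rfl hr hrt) (hintegrable _ le_rfl hr hrt)]
    simp [mul_sub]
  rw [← intervalIntegral.integral_add_adjacent_intervals (hintegrable (θ t) le_rfl hr hrt)
    (hintegrable (θ t) hr hrt le_rfl)]
  linarith

/-- The profile rate of the initial depth on `[x₀(0), b]`. Along the shoreline it turns out to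
equal `∫₀ᵗ (θ(t) - θ(s)) ds`, which makes it both observable and linked to the initial data. -/
noncomputable def depthRate (η : ℝ → ℝ → ℝ) (x₀ : ℝ → ℝ) (b : ℝ) : ℝ → ℝ :=
  profileRate (x₀ 0) b (fun x => depth η x 0) (fun x => (1 + dx η x 0)⁻¹)
    (deriv fun x => (1 + dx η x 0)⁻¹)

namespace IsFlow

variable {T : EReal} {η u : ℝ → ℝ → ℝ} {x₀ : ℝ → ℝ} {b t : ℝ}

theorem isProfile_depth (hflow : IsFlow T η u x₀) (hbreak : NoBreaking T η u x₀) (hT : 0 < T)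
    (hb : x₀ 0 ≤ b) :
    IsProfile (x₀ 0) b (fun x => depth η x 0) (fun x => (1 + dx η x 0)⁻¹)
      (deriv fun x => (1 + dx η x 0)⁻¹) := by
  have h0 : (0 : ℝ) ∈ times T := ⟨le_rfl, hT⟩
  have hsmooth : ∀ x ∈ Icc (x₀ 0) b, ContDiffAt ℝ 1 (fun x => (1 + dx η x 0)⁻¹) x := fun x hx =>
    (contDiffAt_const.add ((contDiffAt_dx (hflow.contDiffAt_η h0 hx.1) one_add_one_eq_two.le).comp
      (f := fun x : ℝ => (x, (0 : ℝ))) x (by fun_prop))).inv (hflow.slope_pos hbreak h0 hx.1).ne'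
  exact {
    le := hb
    apply_left := hflow.shore_eq 0 h0
    pos := fun x hx => inv_pos.2 (hflow.slope_pos hbreak h0 hx.1)
    hasDerivAt := fun x hx => (inv_inv (1 + dx η x 0)).symm ▸ hflow.hasDerivAt_depth h0 hx.1
    hasDerivAt_recip := fun x hx => ((hsmooth x hx).differentiableAt one_ne_zero).hasDerivAt
    continuousOn_deriv := fun x hx =>
      ((hsmooth x hx).derivWithin (m := 0) le_rfl).continuousAt.continuousWithinAt }

theorem depthRate_shoreτ (hflow : IsFlow T η u x₀) (hbreak : NoBreaking T η u x₀)
    (hu₀ : ∀ x, x₀ 0 ≤ x → u x 0 = 0) (ht : t ∈ times T) (hb : x₀ 0 ≤ b)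
    (htb : shoreτ x₀ t ^ 2 ≤ depth η b 0) :
    depthRate η x₀ b (shoreτ x₀ t) = ∫ s in (0 : ℝ)..t, shoreτ x₀ t - shoreτ x₀ s := by
  have h0 := times_of_le ht le_rfl ht.1
  have hθ₀ := hflow.shoreτ_zero hbreak h0.2 (hu₀ _ le_rfl)
  rcases ht.1.eq_or_lt with rfl | hpos
  · simp [depthRate, profileRate, hθ₀]
  have hmono := hflow.strictMonoOn_shoreτ hbreak
  have hS : 0 < shoreτ x₀ t := hθ₀ ▸ hmono h0 ht hpos
  have hrate := (hflow.isProfile_depth hbreak h0.2 hb).profileRate_eq ht.1 hS htb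
    ((hflow.continuousOn_shoreτ hbreak).mono (Icc_subset_times ht))
    (fun R hR => hflow.integral_sqrt_sq_sub_depth hbreak hu₀ ht hR hb
      ((pow_le_pow_left₀ hR.1 hR.2 2).trans htb)) (right_mem_Icc.2 hS.le)
  refine hrate.trans (intervalIntegral.integral_congr fun s hs => ?_)
  rw [uIcc_of_le ht.1] at hs
  exact max_eq_left (sub_nonneg.2 (hmono.monotoneOn (Icc_subset_times ht hs) ht hs.2))

theorem integral_shoreτ (hflow : IsFlow T η u x₀) (hbreak : NoBreaking T η u x₀)
    (ht : t ∈ times T) :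
    ∫ s in (0 : ℝ)..t, shoreτ x₀ s = (t ^ 2 / 2 - (x₀ t - x₀ 0)) / 2 := by
  have hsub := Icc_subset_times ht
  rw [intervalIntegral.integral_eq_sub_of_hasDerivAt_of_le ht.1
    (f := fun s => (s ^ 2 / 2 - x₀ s) / 2)
    ((ContinuousOn.sub (by fun_prop) (hflow.shore_cont.mono hsub)).div_const 2)
    (fun s hs => ?_)
    (((hflow.continuousOn_shoreτ hbreak).mono hsub).intervalIntegrable_of_Icc ht.1)]
  · ring
  · have hsT := hsub (Ioo_subset_Icc_self hs)
    refine ((((hasDerivAt_pow 2 s).div_const 2).sub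
      (hflow.hasDerivAt_shore hbreak hsT hs.1)).div_const 2).congr_deriv ?_
    rw [hflow.shoreτ_eq hbreak hsT, cgτ]
    push_cast
    ring

theorem shoreΨ_shoreτ_eq_sub_depthRate (hflow : IsFlow T η u x₀) (hbreak : NoBreaking T η u x₀)
    (hu₀ : ∀ x, x₀ 0 ≤ x → u x 0 = 0) (ht : t ∈ times T) (hb : x₀ 0 ≤ b)
    (htb : shoreτ x₀ t ^ 2 ≤ depth η b 0) :
    shoreΨ T x₀ (shoreτ x₀ t)
      = -x₀ 0 + 2 * shoreτ x₀ t ^ 2 - 2 * depthRate η x₀ b (shoreτ x₀ t) := by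
  have hθint : IntervalIntegrable (shoreτ x₀) volume 0 t :=
    ((hflow.continuousOn_shoreτ hbreak).mono (Icc_subset_times ht)).intervalIntegrable_of_Icc ht.1
  rw [hflow.shoreΨ_shoreτ hbreak ht, hflow.depthRate_shoreτ hbreak hu₀ ht hb htb,
    intervalIntegral.integral_sub intervalIntegrable_const hθint, hflow.integral_shoreτ hbreak ht,
    intervalIntegral.integral_const]
  simp only [shoreτ, smul_eq_mul, sub_zero]
  ring

theorem eqOn_shoreΨ (hflow : IsFlow T η u x₀) (hbreak : NoBreaking T η u x₀)
    (hu₀ : ∀ x, x₀ 0 ≤ x → u x 0 = 0) (ht : t ∈ times T) (hb : x₀ 0 ≤ b)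
    (htb : shoreτ x₀ t ^ 2 ≤ depth η b 0) :
    EqOn (shoreΨ T x₀) (fun ρ => -x₀ 0 * 1 + 2 * ρ ^ 2 + -2 * depthRate η x₀ b ρ)
      (Icc 0 (shoreτ x₀ t)) := fun ρ hρ => by
  obtain ⟨r, hr, rfl⟩ := hflow.exists_shoreτ_eq hbreak (hu₀ _ le_rfl) ht hρ
  rw [hflow.shoreΨ_shoreτ_eq_sub_depthRate hbreak hu₀ (Icc_subset_times ht hr) hb
    ((pow_le_pow_left₀ hρ.1 hρ.2 2).trans htb)]
  ring

theorem intervalIntegrable_shoreΨ_div_sqrt (hflow : IsFlow T η u x₀)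
    (hbreak : NoBreaking T η u x₀) (hu₀ : ∀ x, x₀ 0 ≤ x → u x 0 = 0) (ht : t ∈ times T)
    (hS : 0 < shoreτ x₀ t) :
    IntervalIntegrable (fun ρ => shoreΨ T x₀ ρ / √(shoreτ x₀ t ^ 2 - ρ ^ 2)) volume 0
      (shoreτ x₀ t) := by
  obtain ⟨b, hb, htb⟩ := hflow.exists_sq_shoreτ_le_depth hbreak hu₀ ht
  have hrate := (hflow.isProfile_depth hbreak (times_of_le ht le_rfl ht.1).2
    hb).continuousOn_profileRate (shoreτ x₀ t)
  refine intervalIntegrable_div_sqrt_sq_sub_sq hS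
    (ContinuousOn.congr ?_ (hflow.eqOn_shoreΨ hbreak hu₀ ht hb htb))
  exact ContinuousOn.add (by fun_prop) (continuousOn_const.mul hrate)

theorem abel_shoreΨ (hflow : IsFlow T η u x₀) (hbreak : NoBreaking T η u x₀)
    (hu₀ : ∀ x, x₀ 0 ≤ x → u x 0 = 0) (ht : t ∈ times T) (hS : 0 < shoreτ x₀ t)
    (hb : x₀ 0 ≤ b) (htb : depth η b 0 = shoreτ x₀ t ^ 2) :
    abel (shoreΨ T x₀) (shoreτ x₀ t) = Real.pi / 2 * (shoreτ x₀ t ^ 2 - b) := by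
  have hprof := hflow.isProfile_depth hbreak (times_of_le ht le_rfl ht.1).2 hb
  have hrate : abel (depthRate η x₀ b) (shoreτ x₀ t) = Real.pi / 4 * (b - x₀ 0) :=
    hprof.abel_profileRate hS htb
  have hcont : ContinuousOn (fun ρ => -2 * depthRate η x₀ b ρ) (Icc 0 (shoreτ x₀ t)) :=
    continuousOn_const.mul (hprof.continuousOn_profileRate _)
  rw [abel_congr hS.le (hflow.eqOn_shoreΨ hbreak hu₀ ht hb htb.ge),
    abel_add hS (f := fun ρ => -x₀ 0 * 1 + 2 * ρ ^ 2) (by fun_prop) hcont,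
    abel_add hS (by fun_prop) (by fun_prop), abel_const_mul, abel_const_mul, abel_const_mul,
    abel_one hS, abel_sq hS, hrate]
  ring

theorem sqrt_depth_mem_observed (hflow : IsFlow ⊤ η u x₀) (hbreak : NoBreaking ⊤ η u x₀)
    (hu₀ : ∀ x, x₀ 0 ≤ x → u x 0 = 0) (hb : x₀ 0 ≤ b) :
    √(depth η b 0) ∈ observed ⊤ x₀ := by
  have hmem (t : ℝ) (ht : 0 ≤ t) : t ∈ times ⊤ := ⟨ht, EReal.coe_lt_top t⟩
  have hT : (0 : EReal) < ⊤ := EReal.zero_lt_top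
  have hnonneg := fun t ht => hflow.shoreτ_nonneg hbreak (hu₀ _ le_rfl) (hmem t ht)
  by_contra hnot
  have hsq (t : ℝ) (ht : 0 ≤ t) : shoreτ x₀ t ^ 2 ≤ depth η b 0 := by
    refine (Real.le_sqrt (hnonneg t ht) ?_).1 (not_lt.1 fun hlt => hnot ?_)
    · exact hflow.depth_nonneg (hmem 0 le_rfl) hb
    · refine (hflow.ordConnected_observed hbreak).out (mem_image_of_mem _ (hmem 0 le_rfl))
        (mem_image_of_mem _ (hmem t ht)) ⟨?_, hlt.le⟩
      exact (hflow.shoreτ_zero hbreak hT (hu₀ _ le_rfl)).trans_le (Real.sqrt_nonneg _)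
  obtain ⟨C, hC0, hC⟩ := (hflow.isProfile_depth hbreak hT hb).exists_profileRate_sub_le
  have ht₁ : 0 ≤ C + 1 := by positivity
  have ht₂ : 0 ≤ C + 1 + 1 := by positivity
  have hmono := hflow.strictMonoOn_shoreτ hbreak
  have hlt := hmono (hmem _ ht₁) (hmem _ ht₂) (lt_add_one (C + 1))
  have hupper : depthRate η x₀ b _ - depthRate η x₀ b _ ≤ _ :=
    hC _ _ (hnonneg _ ht₁) hlt.le (hsq _ ht₂)
  have hlower := mul_sub_le_integral_sub_integral ht₁ (lt_add_one (C + 1)).le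
    ((hflow.continuousOn_shoreτ hbreak).mono (Icc_subset_times (hmem _ ht₂)))
    (hmono.monotoneOn.mono (Icc_subset_times (hmem _ ht₂)))
  rw [hflow.depthRate_shoreτ hbreak hu₀ (hmem _ ht₂) hb (hsq _ ht₂),
    hflow.depthRate_shoreτ hbreak hu₀ (hmem _ ht₁) hb (hsq _ ht₁)] at hupper
  linarith

end IsFlow

end InitialProfile

section InitialData

variable {a : ℝ} {η₀ : ℝ → ℝ} {σ x y : ℝ}

theorem initγ_spec (h : ∃ x, a ≤ x ∧ x + η₀ x = σ ^ 2) :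
    a ≤ initγ a η₀ σ ∧ initγ a η₀ σ + η₀ (initγ a η₀ σ) = σ ^ 2 :=
  ⟨Function.invFunOn_mem h, Function.invFunOn_eq h⟩

theorem eq_initγ (hmono : StrictMonoOn (fun x => x + η₀ x) (Ici a)) (hx : a ≤ x)
    (hσ : x + η₀ x = σ ^ 2) : x = initγ a η₀ σ :=
  have hspec := initγ_spec ⟨x, hx, hσ⟩
  hmono.injOn hx hspec.1 (hσ.trans hspec.2.symm)

theorem initψ_sqrt (hmono : StrictMonoOn (fun x => x + η₀ x) (Ici a)) (hx : a ≤ x)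
    (hpos : 0 ≤ x + η₀ x) : initψ a η₀ √(x + η₀ x) = η₀ x := by
  rw [initψ, ← eq_initγ hmono hx (Real.sq_sqrt hpos).symm]

theorem eq_of_eq_initψ_sqrt (h : ∃ z, a ≤ z ∧ z + η₀ z = √(x + y) ^ 2) (hpos : 0 ≤ x + y)
    (hy : y = initψ a η₀ √(x + y)) : y = η₀ x := by
  have hγ : initγ a η₀ √(x + y) = x := by
    have hspec : initγ a η₀ √(x + y) + initψ a η₀ √(x + y) = √(x + y) ^ 2 := (initγ_spec h).2
    rw [Real.sq_sqrt hpos, ← hy] at hspec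
    exact add_right_cancel hspec
  rw [hy, initψ, hγ]

namespace IsFlow

variable {T : EReal} {η u : ℝ → ℝ → ℝ} {x₀ : ℝ → ℝ}

theorem strictMonoOn_add_initial (hflow : IsFlow T η u x₀) (hbreak : NoBreaking T η u x₀)
    (hT : 0 < T) (hη₀ : ∀ x, x₀ 0 ≤ x → η x 0 = η₀ x) :
    StrictMonoOn (fun x => x + η₀ x) (Ici (x₀ 0)) :=
  (hflow.strictMonoOn_depth hbreak ⟨le_rfl, hT⟩).congr fun x hx =>
    congrArg (x + ·) (hη₀ x hx)

theorem exists_add_initial_eq_sq (hflow : IsFlow T η u x₀) (hbreak : NoBreaking T η u x₀)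
    (hη₀ : ∀ x, x₀ 0 ≤ x → η x 0 = η₀ x) (hu₀ : ∀ x, x₀ 0 ≤ x → u x 0 = 0)
    (hσ : σ ∈ observed T x₀) : ∃ x, x₀ 0 ≤ x ∧ x + η₀ x = σ ^ 2 := by
  obtain ⟨t, ht, rfl⟩ := hσ
  have h0 := times_of_le ht le_rfl ht.1
  obtain ⟨b, hb, htb⟩ := hflow.exists_sq_shoreτ_le_depth hbreak hu₀ ht
  obtain ⟨x, hx, hxt⟩ := intermediate_value_Icc hb
    ((hflow.continuousOn_depth h0).mono Icc_subset_Ici_self)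
    ⟨(hflow.shore_eq 0 h0).trans_le (sq_nonneg (shoreτ x₀ t)), htb⟩
  exact ⟨x, hx.1, (congrArg (x + ·) (hη₀ x hx.1)).symm.trans hxt⟩

theorem initψ_eq_abel_shoreΨ (hflow : IsFlow T η u x₀) (hbreak : NoBreaking T η u x₀)
    (hη₀ : ∀ x, x₀ 0 ≤ x → η x 0 = η₀ x) (hu₀ : ∀ x, x₀ 0 ≤ x → u x 0 = 0)
    (hσ : σ ∈ observed T x₀) (hpos : 0 < σ) :
    initψ (x₀ 0) η₀ σ = 2 / Real.pi * abel (shoreΨ T x₀) σ := by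
  obtain ⟨hγ, hγσ⟩ := initγ_spec (hflow.exists_add_initial_eq_sq hbreak hη₀ hu₀ hσ)
  obtain ⟨t, ht, rfl⟩ := hσ
  rw [hflow.abel_shoreΨ hbreak hu₀ ht hpos hγ ((congrArg (_ + ·) (hη₀ _ hγ)).trans hγσ), initψ,
    ← hγσ]
  field_simp
  ring

end IsFlow

end InitialData

end SlopingBeach

open SlopingBeach in
theorem mainTheorem2 (T : EReal) (hT : 0 < T) (η u : ℝ → ℝ → ℝ) (x₀ η₀ : ℝ → ℝ)
    (hflow : IsFlow T η u x₀)
    (hη₀ : ∀ x, x₀ 0 ≤ x → η x 0 = η₀ x)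
    (hu₀ : ∀ x, x₀ 0 ≤ x → u x 0 = 0)
    (hbreak : NoBreaking T η u x₀) :
    -- the shoreline moves with the flow velocity
    (∀ t ∈ times T, HasDerivWithinAt x₀ (u (x₀ t) t) (Set.Ici 0) t) ∧
    -- `Ψ` is well defined by the shoreline data, on an interval starting at `0`
    (shoreτ x₀ 0 = 0 ∧ StrictMonoOn (shoreτ x₀) (times T) ∧ (observed T x₀).OrdConnected ∧
      ∀ t ∈ times T, shoreΨ T x₀ (shoreτ x₀ t) = -x₀ t + shoreVel x₀ t ^ 2 / 2) ∧
    -- `γ` is well defined on that interval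
    (∀ σ ∈ observed T x₀,
      (x₀ 0 ≤ initγ (x₀ 0) η₀ σ ∧ initγ (x₀ 0) η₀ σ + η₀ (initγ (x₀ 0) η₀ σ) = σ ^ 2) ∧
      ∀ x, x₀ 0 ≤ x → x + η₀ x = σ ^ 2 → x = initγ (x₀ 0) η₀ σ) ∧
    -- `ψ₀ = (2/π) 𝒜Ψ`
    (∀ σ ∈ observed T x₀, 0 < σ →
      IntervalIntegrable (fun s => shoreΨ T x₀ s / Real.sqrt (σ ^ 2 - s ^ 2))
        MeasureTheory.volume 0 σ ∧
      initψ (x₀ 0) η₀ σ = 2 / Real.pi * abel (shoreΨ T x₀) σ) ∧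
    -- `η₀(x) = ψ₀(σ)` with `σ = √(x + η₀(x))`, and this implicit equation,
    -- with `ψ₀ = (2/π) 𝒜Ψ`, determines `η₀(x)`
    (∀ x, x₀ 0 < x → Real.sqrt (x + η₀ x) ∈ observed T x₀ →
      η₀ x = initψ (x₀ 0) η₀ (Real.sqrt (x + η₀ x)) ∧
      η₀ x = 2 / Real.pi * abel (shoreΨ T x₀) (Real.sqrt (x + η₀ x)) ∧
      ∀ y, 0 < x + y → Real.sqrt (x + y) ∈ observed T x₀ →
        y = 2 / Real.pi * abel (shoreΨ T x₀) (Real.sqrt (x + y)) → y = η₀ x) ∧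
    η₀ (x₀ 0) = -x₀ 0 ∧
    -- if the wave never breaks, the whole initial displacement is recovered
    (T = ⊤ → ∀ x, x₀ 0 ≤ x → Real.sqrt (x + η₀ x) ∈ observed T x₀) := by
  have hmono := hflow.strictMonoOn_add_initial hbreak hT hη₀
  have hγ := fun σ (hσ : σ ∈ observed T x₀) => hflow.exists_add_initial_eq_sq hbreak hη₀ hu₀ hσ
  have hψ := fun σ (hσ : σ ∈ observed T x₀) (hpos : 0 < σ) =>
    hflow.initψ_eq_abel_shoreΨ hbreak hη₀ hu₀ hσ hpos
  have hdepth (x : ℝ) (hx : x₀ 0 ≤ x) : depth η x 0 = x + η₀ x := congrArg (x + ·) (hη₀ x hx)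
  refine ⟨fun t ht => hflow.hasDerivWithinAt_shore hbreak ht,
    ⟨hflow.shoreτ_zero hbreak hT (hu₀ _ le_rfl), hflow.strictMonoOn_shoreτ hbreak,
      hflow.ordConnected_observed hbreak, fun t ht => hflow.shoreΨ_shoreτ hbreak ht⟩,
    fun σ hσ => ⟨initγ_spec (hγ σ hσ), fun x hx hxσ => eq_initγ hmono hx hxσ⟩,
    fun σ hσ hpos => ⟨?_, hψ σ hσ hpos⟩, fun x hx hmem => ?_, ?_, fun hTop x hx => ?_⟩
  · obtain ⟨t, ht, rfl⟩ := hσ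
    exact hflow.intervalIntegrable_shoreΨ_div_sqrt hbreak hu₀ ht hpos
  · have hpos : 0 < x + η₀ x := hdepth x hx.le ▸ hflow.depth_pos 0 ⟨le_rfl, hT⟩ x hx
    have hinit := initψ_sqrt hmono hx.le hpos.le
    exact ⟨hinit.symm, hinit.symm.trans (hψ _ hmem (Real.sqrt_pos.2 hpos)), fun y hy hymem hyeq =>
      eq_of_eq_initψ_sqrt (hγ _ hymem) hy.le (hyeq.trans (hψ _ hymem (Real.sqrt_pos.2 hy)).symm)⟩
  · exact eq_neg_of_add_eq_zero_right
      ((hdepth _ le_rfl).symm.trans (hflow.shore_eq 0 ⟨le_rfl, hT⟩))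
  · subst hTop
    exact hdepth x hx ▸ hflow.sqrt_depth_mem_observed hbreak hu₀ hx
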